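/- For a finite simple graph $G=(V,E)$ and $v\in V$, the push protocol over $G$ started at $v$ has informed sets $I(0)=\{v\}$ and $I(t+1)=I(t)\cup\{v_u^t : u\in I(t)\}$, where $v_u^t$ is a uniformly random neighbor of $u$ in $G$, all choices (over $u$ and $t$) being independent; a vertex without neighbors calls nobody. Its runtime is $\mathcal T_v(G)=\min\{t\in\mathbb N : I(t)=V\}$, with $\mathcal T_v(G)=\infty$ if there is no such $t$. For $p\in[0,1]$, $G_p$ is the random subgraph of $G$ on the vertex set $V$ obtained by removing each edge independently with probability $1-p$; $\mathcal T_v(G_p)$ is the runtime of the protocol run over $G_p$, the protocol's choices being made, given $G_p$, as above. "With high probability" means with probability tending to $1$ as $n\to\infty$. **Theorem.** Let $(G_n)_n$ be a sequence of finite simple graphs $G_n=(V_n,E_n)$ with $|V_n|\to\infty$ (for instance $|V_n|=n$), where $G_n$ is $d_n$-regular, and let $v_n\in V_n$. Let $(T_n)_n$ be a sequence of real numbers such that $\mathcal T_{v_n}(G_n)\le T_n$ with high probability. Then for every $\epsilon>0$ and every sequence $(p_n)_n$ with $0<p_n<1$ and $T_n=o(p_nd_n)$, we have $\mathcal T_{v_n}(G_{n,p_n})\le(1+\epsilon)T_n$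 with high probability, where the probability is over both the choice of $G_{n,p_n}$ and the randomness of the push protocol. -/

import Mathlib

open MeasureTheory

namespace RumorSpreading

/-- Bond percolation: the law of the random subgraph of `G` (on the same vertex set) in which each
edge of `G` is kept independently with probability `p`, and removed otherwise. -/
noncomputable def percolation {V : Type*} (G : SimpleGraph V) (p : unitInterval) :
    Measure (SimpleGraph V) :=
  (ProbabilityTheory.setBernoulli G.edgeSet p).map SimpleGraph.fromEdgeSet

instance {V : Type*} (G : SimpleGraph V) (p : unitInterval) :
    IsProbabilityMeasure (percolation G p) :=
  Measure.isProbabilityMeasure_map SimpleGraph.measurable_fromEdgeSet.aemeasurable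

/-- The law of the vertex called by `u` in one round over the graph `H`: uniform on the neighbours
of `u`. A vertex without neighbours calls itself, which has no effect. -/
noncomputable def callLaw {V : Type*} [MeasurableSpace V] (H : SimpleGraph V) (u : V) :
    Measure V :=
  open Classical in
  if (H.neighborSet u).Nonempty then ProbabilityTheory.uniformOn (H.neighborSet u)
  else Measure.dirac u

instance {V : Type*} [Finite V] [MeasurableSpace V] [DiscreteMeasurableSpace V]
    (H : SimpleGraph V) (u : V) : IsProbabilityMeasure (callLaw H u) := by
  unfold callLaw
  split_ifs with h
  · exact ProbabilityTheory.isProbabilityMeasure_uniformOn (Set.toFinite _) h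
  · infer_instance

/-- The randomness of the push protocol over `H`: the calls `c (t, u)` of the vertices `u` in the
rounds `t = 0, 1, 2, …`, all independent. The calls of a vertex that is not yet informed are
ignored by the protocol. -/
noncomputable def pushLaw {V : Type*} [Finite V] [MeasurableSpace V] [DiscreteMeasurableSpace V]
    (H : SimpleGraph V) : Measure (ℕ × V → V) :=
  Measure.infinitePi fun i : ℕ × V => callLaw H i.2

instance {V : Type*} [Finite V] [MeasurableSpace V] [DiscreteMeasurableSpace V]
    (H : SimpleGraph V) : IsProbabilityMeasure (pushLaw H) := by
  unfold pushLaw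
  infer_instance

/-- The set of vertices that are informed at time `t`, if the protocol starts at `v` and the calls
are given by `c`. -/
def informed {V : Type*} (v : V) (c : ℕ × V → V) : ℕ → Set V
  | 0 => {v}
  | t + 1 => informed v c t ∪ (fun u => c (t, u)) '' informed v c t

/-- The runtime of the push protocol: the first time at which all vertices are informed
(`⊤` if this never happens). -/
noncomputable def runtime {V : Type*} (v : V) (c : ℕ × V → V) : ℕ∞ :=
  sInf ((fun t : ℕ => (t : ℕ∞)) '' {t : ℕ | informed v c t = Set.univ})

/-- The runtime is at most the real number `x`. -/
def RuntimeLE {V : Type*} (v : V) (c : ℕ × V → V) (x : ℝ) : Prop :=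
  ∃ t : ℕ, runtime v c = t ∧ (t : ℝ) ≤ x

instance {V : Type*} [Finite V] : MeasurableSingletonClass (SimpleGraph V) where
  measurableSet_singleton H := by
    have h : ({H} : Set (SimpleGraph V)) = SimpleGraph.edgeSet ⁻¹' {H.edgeSet} := by
      ext K
      simp
    rw [h]
    exact SimpleGraph.measurable_edgeSet (MeasurableSet.singleton _)

/-- The law of the push protocol as a kernel: given the graph `H`, the calls have law
`pushLaw H`. -/
noncomputable def pushKernel (V : Type*) [Finite V] [MeasurableSpace V]
    [DiscreteMeasurableSpace V] : ProbabilityTheory.Kernel (SimpleGraph V) (ℕ × V → V) :=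
  ProbabilityTheory.Kernel.ofFunOfCountable pushLaw

instance (V : Type*) [Finite V] [MeasurableSpace V] [DiscreteMeasurableSpace V] :
    ProbabilityTheory.IsMarkovKernel (pushKernel V) :=
  ⟨fun H => inferInstanceAs (IsProbabilityMeasure (pushLaw H))⟩

/-- The joint law of the percolated graph of `G` and of the calls of the push protocol over that
percolated graph: first the percolated graph `H` is drawn, and then, given `H`, the calls are drawn
from `pushLaw H`. -/
noncomputable def percolatedPushLaw {V : Type*} [Finite V] [MeasurableSpace V]
    [DiscreteMeasurableSpace V] (G : SimpleGraph V) (p : unitInterval) :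
    Measure (SimpleGraph V × (ℕ × V → V)) :=
  (percolation G p).compProd (pushKernel V)

/-- The events `E k` hold with high probability: their probabilities tend to `1`. -/
def WithHighProbability {Ω : ℕ → Type*} [∀ k, MeasurableSpace (Ω k)]
    (P : ∀ k, Measure (Ω k)) (E : ∀ k, Set (Ω k)) : Prop :=
  Filter.Tendsto (fun k => P k (E k)) Filter.atTop (nhds 1)

end RumorSpreading

namespace RumorSpreading

section Resampling

variable {ι X : Type*} [DecidableEq ι] [MeasurableSpace X] (μ : ι → Measure X)
  [∀ i, IsProbabilityMeasure (μ i)]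

/-- Resampling one coordinate of a product measure does not change it. -/
theorem measurePreserving_update (i : ι) :
    MeasurePreserving (fun z : (ι → X) × X => Function.update z.1 i z.2)
      ((Measure.infinitePi μ).prod (μ i)) (Measure.infinitePi μ) := by
  have hm : Measurable (fun z : (ι → X) × X => Function.update z.1 i z.2) := by
    refine measurable_pi_lambda _ fun j => ?_
    by_cases h : j = i
    · subst h; simpa using measurable_snd
    · simp only [Function.update_of_ne h]
      exact (measurable_pi_apply j).comp measurable_fst
  refine ⟨hm, Measure.eq_infinitePi _ fun s t ht => ?_⟩
  rw [Measure.map_apply hm (MeasurableSet.pi s.countable_toSet fun j _ => ht j)]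
  by_cases hi : i ∈ s
  · have : (fun z : (ι → X) × X => Function.update z.1 i z.2) ⁻¹' (s : Set ι).pi t
        = ((s.erase i : Finset ι) : Set ι).pi t ×ˢ t i := by
      ext ⟨c, x⟩
      simp only [Set.mem_preimage, Set.mem_pi, Set.mem_prod, Finset.coe_erase]
      constructor
      · intro h
        refine ⟨fun j hj => ?_, by simpa using h i hi⟩
        have := h j hj.1
        rwa [Function.update_of_ne hj.2] at this
      · rintro ⟨h1, h2⟩ j hj
        by_cases hji : j = i
        · subst hji; simpa using h2
        · rw [Function.update_of_ne hji]
          exact h1 j ⟨hj, hji⟩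
    rw [this, Measure.prod_prod, Measure.infinitePi_pi _ (fun j _ => ht j), mul_comm,
      Finset.mul_prod_erase s (fun j => μ j (t j)) hi]
  · have : (fun z : (ι → X) × X => Function.update z.1 i z.2) ⁻¹' (s : Set ι).pi t
        = (s : Set ι).pi t ×ˢ Set.univ := by
      ext ⟨c, x⟩
      simp only [Set.mem_preimage, Set.mem_pi, Set.mem_prod, Set.mem_univ, and_true]
      refine forall₂_congr fun j hj => ?_
      rw [Function.update_of_ne (fun h => hi (by rw [← h]; exact hj))]
    rw [this, Measure.prod_prod, Measure.infinitePi_pi _ (fun j _ => ht j)]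
    simp

/-- The coordinate `i` is independent of everything that does not depend on it. -/
theorem integral_coordinate_eq_sum [Fintype X] [DiscreteMeasurableSpace X] (i : ι)
    {A : X → (ι → X) → ℝ} (hA : ∀ x, Measurable (A x)) {C : ℝ} (hC : ∀ x c, |A x c| ≤ C)
    (hinv : ∀ x y c, A x (Function.update c i y) = A x c) :
    ∫ c, A (c i) c ∂(Measure.infinitePi μ)
      = ∑ x, (μ i).real {x} * ∫ c, A x c ∂(Measure.infinitePi μ) := by
  have hm : Measurable (fun c : ι → X => A (c i) c) := by
    have : Measurable (fun z : X × (ι → X) => A z.1 z.2) :=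
      measurable_from_prod_countable_right hA
    have h2 : Measurable (fun c : ι → X => (c i, c)) :=
      (measurable_pi_apply i).prodMk measurable_id
    exact this.comp h2
  have hmp := measurePreserving_update μ i
  rw [← hmp.map_eq, integral_map hmp.measurable.aemeasurable
    (by rw [hmp.map_eq]; exact hm.aestronglyMeasurable)]
  have hm' := hm.comp hmp.measurable
  have hint : Integrable (fun z : (ι → X) × X =>
      A (Function.update z.1 i z.2 i) (Function.update z.1 i z.2))
      ((Measure.infinitePi μ).prod (μ i)) :=
    Integrable.of_bound hm'.aestronglyMeasurable C
      (Filter.Eventually.of_forall fun z => hC _ _)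
  rw [integral_prod_symm _ hint, integral_fintype (Integrable.of_finite), hmp.map_eq]
  simp [hinv]

end Resampling

section Rounds

variable {V : Type*} [Fintype V]

open Classical in
/-- The expected value of `f` at the informed set, after the vertices in a list have made one
independent call each, where `u` calls `w` with probability `K u w`. -/
noncomputable def callAll (K : V → V → ℝ) (f : Finset V → ℝ) : List V → Finset V → ℝ
  | [], I => f I
  | u :: L, I => ∑ w, K u w * callAll K f L (insert w I)

open Classical in
/-- The probability that the push protocol in which `u` calls `w` with probability `K u w`
informs everybody within the given number of rounds, if it starts with the given informed set. -/
noncomputable def successProb (K : V → V → ℝ) : ℕ → Finset V → ℝ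
  | 0, I => if I = Finset.univ then 1 else 0
  | k + 1, I => callAll K (successProb K k) I.toList I

theorem callAll_nonneg {K : V → V → ℝ} (hK : ∀ u w, 0 ≤ K u w) {f : Finset V → ℝ}
    (hf : ∀ I, 0 ≤ f I) (L : List V) (I : Finset V) : 0 ≤ callAll K f L I := by
  induction L generalizing I with
  | nil => exact hf I
  | cons u L ih => exact Finset.sum_nonneg fun w _ => mul_nonneg (hK u w) (ih _)

theorem callAll_le_one {K : V → V → ℝ} (hK : ∀ u w, 0 ≤ K u w) (hK1 : ∀ u, ∑ w, K u w = 1)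
    {f : Finset V → ℝ} (hf : ∀ I, f I ≤ 1) (L : List V) (I : Finset V) :
    callAll K f L I ≤ 1 := by
  induction L generalizing I with
  | nil => exact hf I
  | cons u L ih =>
    calc _ ≤ ∑ w, K u w * 1 :=
        Finset.sum_le_sum fun w _ => mul_le_mul_of_nonneg_left (ih _) (hK u w)
      _ = 1 := by simp [hK1]

theorem callAll_mono {K : V → V → ℝ} (hK : ∀ u w, 0 ≤ K u w) {f : Finset V → ℝ}
    (hf : Monotone f) (L : List V) : Monotone (callAll K f L) := by
  classical
  induction L with
  | nil => exact hf
  | cons u L ih =>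
    intro I J h
    exact Finset.sum_le_sum fun w _ =>
      mul_le_mul_of_nonneg_left (ih (Finset.insert_subset_insert _ h)) (hK u w)

theorem successProb_nonneg {K : V → V → ℝ} (hK : ∀ u w, 0 ≤ K u w) (k : ℕ) (I : Finset V) :
    0 ≤ successProb K k I := by
  induction k generalizing I with
  | zero => unfold successProb; split_ifs <;> simp
  | succ k ih => exact callAll_nonneg hK ih _ _

theorem successProb_le_one {K : V → V → ℝ} (hK : ∀ u w, 0 ≤ K u w) (hK1 : ∀ u, ∑ w, K u w = 1)
    (k : ℕ) (I : Finset V) : successProb K k I ≤ 1 := by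
  induction k generalizing I with
  | zero => unfold successProb; split_ifs <;> simp
  | succ k ih => exact callAll_le_one hK hK1 ih _ _

theorem callAll_perm {K : V → V → ℝ} {f : Finset V → ℝ} {L L' : List V} (h : L.Perm L')
    (I : Finset V) : callAll K f L I = callAll K f L' I := by
  classical
  induction h generalizing I with
  | nil => rfl
  | cons u _ ih => exact Finset.sum_congr rfl fun w _ => by rw [ih]
  | swap u u' L =>
    simp only [callAll, Finset.mul_sum]
    rw [Finset.sum_comm]
    refine Finset.sum_congr rfl fun w _ => Finset.sum_congr rfl fun w' _ => ?_
    rw [Finset.insert_comm]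
    ring
  | trans _ _ ih ih' => rw [ih, ih']

theorem callAll_le_of_sublist {K : V → V → ℝ} (hK : ∀ u w, 0 ≤ K u w)
    (hK1 : ∀ u, ∑ w, K u w = 1) {f : Finset V → ℝ} (hf : Monotone f) {L L' : List V}
    (h : L.Sublist L') (I : Finset V) : callAll K f L I ≤ callAll K f L' I := by
  classical
  induction h generalizing I with
  | slnil => exact le_rfl
  | @cons L L' u _ ih =>
    calc callAll K f L I = ∑ w, K u w * callAll K f L I := by
          rw [← Finset.sum_mul, hK1, one_mul]
      _ ≤ _ := Finset.sum_le_sum fun w _ => mul_le_mul_of_nonneg_left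
          ((callAll_mono hK hf L (Finset.subset_insert w I)).trans (ih _)) (hK u w)
  | cons_cons u _ ih =>
    exact Finset.sum_le_sum fun w _ => mul_le_mul_of_nonneg_left (ih _) (hK u w)

theorem successProb_mono {K : V → V → ℝ} (hK : ∀ u w, 0 ≤ K u w)
    (hK1 : ∀ u, ∑ w, K u w = 1) (k : ℕ) : Monotone (successProb K k) := by
  induction k with
  | zero =>
    intro I J h
    unfold successProb
    by_cases hI : I = Finset.univ
    · have hJ : J = Finset.univ := Finset.univ_subset_iff.1 (hI ▸ h)
      simp [hI, hJ]
    · rw [if_neg hI]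
      split_ifs <;> simp
  | succ k ih =>
    intro I J h
    have hsub : I.toList.Subperm J.toList :=
      List.subperm_of_subset I.nodup_toList fun x hx => by
        simp only [Finset.mem_toList] at hx ⊢
        exact h hx
    obtain ⟨L, hL, hL'⟩ := hsub
    calc successProb K (k + 1) I = callAll K (successProb K k) L I := (callAll_perm hL I).symm
      _ ≤ callAll K (successProb K k) J.toList I := callAll_le_of_sublist hK hK1 ih hL' I
      _ ≤ successProb K (k + 1) J := callAll_mono hK ih _ h

end Rounds

/-- The probability that `u` calls `w`, over the graph `H`. -/
noncomputable def callProb {V : Type*} [MeasurableSpace V] (H : SimpleGraph V) (u w : V) : ℝ :=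
  (callLaw H u).real {w}

section Runtime

variable {V : Type*}

theorem informed_mono (v : V) (c : ℕ × V → V) : Monotone (informed v c) :=
  monotone_nat_of_le_succ fun _ => Set.subset_union_left

theorem runtimeLE_iff (v : V) (c : ℕ × V → V) (x : ℝ) :
    RuntimeLE v c x ↔ 0 ≤ x ∧ informed v c ⌊x⌋₊ = Set.univ := by
  constructor
  · rintro ⟨t, ht, htx⟩
    refine ⟨t.cast_nonneg.trans htx, ?_⟩
    have hne : ((fun t : ℕ => (t : ℕ∞)) '' {t : ℕ | informed v c t = Set.univ}).Nonempty := by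
      by_contra h
      rw [Set.not_nonempty_iff_eq_empty] at h
      simp [runtime, h] at ht
    obtain ⟨t', ht', hmem⟩ := csInf_mem hne
    have htt : t' = t := by
      have : (t' : ℕ∞) = t := hmem.trans ht
      exact_mod_cast this
    subst htt
    have h := informed_mono v c (Nat.le_floor htx)
    exact Set.univ_subset_iff.1 (ht' ▸ h)
  · rintro ⟨hx, h⟩
    have hle : runtime v c ≤ (⌊x⌋₊ : ℕ∞) := csInf_le' ⟨⌊x⌋₊, h, rfl⟩
    obtain ⟨t, ht⟩ := ENat.ne_top_iff_exists.1 (ne_top_of_le_ne_top (ENat.natCast_ne_top _) hle)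
    refine ⟨t, ht.symm, ?_⟩
    rw [← ht] at hle
    exact (Nat.cast_le.2 (by exact_mod_cast hle)).trans (Nat.floor_le hx)

end Runtime

section Synchronous

variable {V : Type*}

open Classical in
/-- The informed set after `k` rounds of calls, from time `t` on, if `I` is informed at time `t`. -/
noncomputable def spread (c : ℕ × V → V) : ℕ → ℕ → Finset V → Finset V
  | 0, _, I => I
  | k + 1, t, I => spread c k (t + 1) (I.toList.foldl (fun J u => insert (c (t, u)) J) I)

open Classical in
theorem coe_foldl_insert (g : V → V) (L : List V) (I : Finset V) :
    ((L.foldl (fun J u => insert (g u) J) I : Finset V) : Set V) = ↑I ∪ g '' {u | u ∈ L} := by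
  induction L generalizing I with
  | nil => simp
  | cons u L ih =>
    rw [List.foldl_cons, ih]
    ext x
    simp only [Finset.coe_insert, Set.mem_union, Set.mem_insert_iff, Finset.mem_coe,
      Set.mem_image, Set.mem_ofPred_eq, List.mem_cons]
    constructor
    · rintro ((h | h) | ⟨y, hy, h⟩)
      · exact Or.inr ⟨u, Or.inl rfl, h.symm⟩
      · exact Or.inl h
      · exact Or.inr ⟨y, Or.inr hy, h⟩
    · rintro (h | ⟨y, rfl | hy, h⟩)
      · exact Or.inl (Or.inr h)
      · exact Or.inl (Or.inl h.symm)
      · exact Or.inr ⟨y, hy, h⟩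

theorem coe_spread (v : V) (c : ℕ × V → V) (k t : ℕ) (I : Finset V) (hI : ↑I = informed v c t) :
    (spread c k t I : Set V) = informed v c (t + k) := by
  induction k generalizing t I with
  | zero => exact hI
  | succ k ih =>
    rw [spread, ih (t + 1), Nat.add_right_comm, Nat.add_assoc]
    rw [coe_foldl_insert (fun u => c (t, u))]
    simp only [Finset.mem_toList, informed, ← hI]
    rfl

open Classical in
theorem spread_update (c : ℕ × V → V) (k t : ℕ) (I : Finset V) (t' : ℕ) (u x : V) (h : t' < t) :
    spread (Function.update c (t', u) x) k t I = spread c k t I := by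
  induction k generalizing t I with
  | zero => rfl
  | succ k ih =>
    rw [spread, spread, ih (t + 1) _ (by omega)]
    congr 2
    funext J w
    rw [Function.update_of_ne]
    intro h'
    have := congrArg Prod.fst h'
    simp only at this
    omega

variable [Fintype V] [MeasurableSpace V] [DiscreteMeasurableSpace V]

theorem measurable_comp_discrete {Ω β : Type*} [MeasurableSpace Ω] [Countable β]
    [MeasurableSpace β] [MeasurableSingletonClass β] {F : β → Ω → ℝ} (hF : ∀ b, Measurable (F b))
    {g : Ω → β} (hg : Measurable g) : Measurable (fun ω => F (g ω) ω) := by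
  have h : Measurable (fun z : β × Ω => F z.1 z.2) := measurable_from_prod_countable_right hF
  have h2 : Measurable (fun ω => (g ω, ω)) := hg.prodMk measurable_id
  exact h.comp h2

open Classical in
theorem measurable_foldl_insert {F : Finset V → (ℕ × V → V) → ℝ} (hF : ∀ J, Measurable (F J))
    (t : ℕ) (L : List V) (I : Finset V) :
    Measurable (fun c => F (L.foldl (fun J u => insert (c (t, u)) J) I) c) := by
  have hg : Measurable (fun c : ℕ × V → V => fun u => c (t, u)) :=
    measurable_pi_lambda _ fun u => measurable_pi_apply _
  exact measurable_comp_discrete (β := V → V)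
    (F := fun g c => F (L.foldl (fun J u => insert (g u) J) I) c) (fun g => hF _) hg

open Classical in
theorem integral_foldl_insert (H : SimpleGraph V) {F : Finset V → (ℕ × V → V) → ℝ}
    (hF : ∀ J, Measurable (F J)) {C : ℝ} (hC : ∀ J c, |F J c| ≤ C) (t : ℕ)
    (hinv : ∀ J u x c, F J (Function.update c (t, u) x) = F J c) (L : List V) (hL : L.Nodup)
    (I : Finset V) :
    ∫ c, F (L.foldl (fun J u => insert (c (t, u)) J) I) c ∂(pushLaw H)
      = callAll (callProb H) (fun J => ∫ c, F J c ∂(pushLaw H)) L I := by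
  induction L generalizing I with
  | nil => rfl
  | cons u L ih =>
    have hu : u ∉ L := (List.nodup_cons.1 hL).1
    have key := integral_coordinate_eq_sum (fun i : ℕ × V => callLaw H i.2) (t, u)
      (A := fun x c => F (L.foldl (fun J u => insert (c (t, u)) J) (insert x I)) c)
      (fun x => measurable_foldl_insert hF t L _) (fun x c => hC _ c) (by
        intro x y c
        rw [hinv]
        congr 1
        refine List.foldl_ext _ _ _ fun J w hw => ?_
        rw [Function.update_of_ne]
        intro h
        have := congrArg Prod.snd h
        simp only at this
        exact hu (this ▸ hw))
    simp only [List.foldl_cons]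
    refine key.trans ?_
    rw [callAll]
    refine Finset.sum_congr rfl fun w _ => ?_
    rw [← ih (List.nodup_cons.1 hL).2]
    rfl

open Classical in
theorem measurable_spread (k t : ℕ) (I : Finset V) :
    Measurable (fun c : ℕ × V → V => if spread c k t I = Finset.univ then (1 : ℝ) else 0) := by
  induction k generalizing t I with
  | zero =>
    by_cases h : I = Finset.univ
    · exact (funext fun c => if_pos h : (fun c : ℕ × V → V =>
        if spread c 0 t I = Finset.univ then (1 : ℝ) else 0) = fun _ => 1) ▸ measurable_const
    · exact (funext fun c => if_neg h : (fun c : ℕ × V → V =>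
        if spread c 0 t I = Finset.univ then (1 : ℝ) else 0) = fun _ => 0) ▸ measurable_const
  | succ k ih => exact measurable_foldl_insert (F := fun J c =>
      if spread c k (t + 1) J = Finset.univ then (1 : ℝ) else 0) (fun J => ih (t + 1) J) t _ I

open Classical in
theorem integral_spread (H : SimpleGraph V) (k t : ℕ) (I : Finset V) :
    ∫ c, (if spread c k t I = Finset.univ then (1 : ℝ) else 0) ∂(pushLaw H)
      = successProb (callProb H) k I := by
  induction k generalizing t I with
  | zero =>
    by_cases h : I = Finset.univ
    · subst h; simp [spread, successProb]
    · have h' (c) : spread c 0 t I ≠ Finset.univ := h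
      simp only [if_neg (h' _), successProb, if_neg h, integral_zero]
  | succ k ih =>
    rw [successProb]
    have := integral_foldl_insert H (F := fun J c =>
      if spread c k (t + 1) J = Finset.univ then (1 : ℝ) else 0)
      (fun J => measurable_spread k (t + 1) J) (C := 1)
      (fun J c => by split_ifs <;> simp) t
      (fun J u x c => by simp only [spread_update c k (t + 1) J t u x (Nat.lt_succ_self t)])
      I.toList I.nodup_toList I
    simp only [ih] at this
    exact this

open Classical in
theorem measurableSet_runtimeLE (v : V) (x : ℝ) :
    MeasurableSet {c : ℕ × V → V | RuntimeLE v c x} := by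
  by_cases hx : 0 ≤ x
  · have : {c : ℕ × V → V | RuntimeLE v c x} = (fun c : ℕ × V → V =>
        if spread c ⌊x⌋₊ 0 {v} = Finset.univ then (1 : ℝ) else 0) ⁻¹' {1} := by
      ext c
      have h := coe_spread v c ⌊x⌋₊ 0 {v} (by simp [informed])
      rw [zero_add] at h
      simp [runtimeLE_iff, hx, ← h]
    rw [this]
    exact measurable_spread _ _ _ (measurableSet_singleton _)
  · have : {c : ℕ × V → V | RuntimeLE v c x} = ∅ := by
      ext c
      simp [runtimeLE_iff, hx]
    rw [this]
    exact MeasurableSet.empty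

theorem pushLaw_real_runtimeLE (H : SimpleGraph V) (v : V) {x : ℝ} (hx : 0 ≤ x) :
    (pushLaw H).real {c | RuntimeLE v c x} = successProb (callProb H) ⌊x⌋₊ {v} := by
  classical
  rw [← integral_spread H ⌊x⌋₊ 0 {v}, ← integral_indicator_one (measurableSet_runtimeLE v x)]
  congr 1
  funext c
  have h := coe_spread v c ⌊x⌋₊ 0 {v} (by simp [informed])
  rw [zero_add] at h
  simp [Set.indicator, runtimeLE_iff, hx, ← h]

end Synchronous

section Lazy

variable {V : Type*}

open Classical in
/-- The calls of the lazy protocol: every call of `K` is dropped with probability `δ`, in which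
case the vertex calls itself. -/
noncomputable def lazy (δ : ℝ) (K : V → V → ℝ) (u w : V) : ℝ :=
  (1 - δ) * K u w + if w = u then δ else 0

theorem lazy_zero (K : V → V → ℝ) : lazy 0 K = K := by
  funext u w
  simp [lazy]

theorem lazy_nonneg {δ : ℝ} (h0 : 0 ≤ δ) (h1 : δ ≤ 1) {K : V → V → ℝ} (hK : ∀ u w, 0 ≤ K u w)
    (u w : V) : 0 ≤ lazy δ K u w := by
  have : 0 ≤ (1 - δ) * K u w := mul_nonneg (by linarith) (hK u w)
  unfold lazy
  split_ifs <;> linarith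

variable [Fintype V]

theorem sum_lazy_mul (δ : ℝ) (K : V → V → ℝ) (u : V) (f : V → ℝ) :
    ∑ w, lazy δ K u w * f w = (1 - δ) * ∑ w, K u w * f w + δ * f u := by
  classical
  simp only [lazy, add_mul, Finset.sum_add_distrib, Finset.mul_sum, mul_assoc, ite_mul, zero_mul]
  rw [Finset.sum_ite_eq' Finset.univ u]
  simp

theorem sum_lazy {δ : ℝ} {K : V → V → ℝ} (hK : ∀ u, ∑ w, K u w = 1) (u : V) :
    ∑ w, lazy δ K u w = 1 := by
  have := sum_lazy_mul δ K u fun _ => 1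
  simp only [mul_one, hK] at this
  rw [this]
  ring

end Lazy

section Asynchronous

variable {V : Type*}

open Classical in
/-- One round of the lazy protocol in which `u` uses its list `c (0, u), c (1, u), …` of calls, one
after the other. The state consists of the positions `s` in these lists and the informed set `I`;
the vertices in the list `L` attempt a call, which succeeds with probability `1 - δ`. This is the
expected value of `f` at the final state. -/
noncomputable def attemptAll (δ : ℝ) (c : ℕ × V → V) (f : (V → ℕ) → Finset V → ℝ) :
    List V → (V → ℕ) → Finset V → ℝ
  | [], s, I => f s I
  | u :: L, s, I => (1 - δ) * attemptAll δ c f L (Function.update s u (s u + 1))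
      (insert (c (s u, u)) I) + δ * attemptAll δ c f L s I

/-- The expected value of `g` at the informed set after some rounds of the lazy protocol with the
lists `c` of calls. -/
noncomputable def expectAfter (δ : ℝ) (c : ℕ × V → V) (g : Finset V → ℝ) :
    ℕ → (V → ℕ) → Finset V → ℝ
  | 0, _, I => g I
  | k + 1, s, I => attemptAll δ c (expectAfter δ c g k) I.toList s I

section Bounds

theorem attemptAll_mono {δ : ℝ} (h0 : 0 ≤ δ) (h1 : δ ≤ 1) (c : ℕ × V → V) {f f' :
    (V → ℕ) → Finset V → ℝ} (h : ∀ s I, f s I ≤ f' s I)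
    (L : List V) (s : V → ℕ) (I : Finset V) :
    attemptAll δ c f L s I ≤ attemptAll δ c f' L s I := by
  induction L generalizing s I with
  | nil => exact h s I
  | cons u L ih =>
    exact add_le_add (mul_le_mul_of_nonneg_left (ih _ _) (by linarith))
      (mul_le_mul_of_nonneg_left (ih _ _) h0)

theorem attemptAll_const {δ : ℝ} (c : ℕ × V → V) (a : ℝ) (L : List V) (s : V → ℕ) (I : Finset V) :
    attemptAll δ c (fun _ _ => a) L s I = a := by
  induction L generalizing s I with
  | nil => rfl
  | cons u L ih => rw [attemptAll, ih, ih]; ring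

theorem abs_attemptAll_le {δ : ℝ} (h0 : 0 ≤ δ) (h1 : δ ≤ 1) (c : ℕ × V → V) {f :
    (V → ℕ) → Finset V → ℝ} {C : ℝ} (h : ∀ s I, |f s I| ≤ C)
    (L : List V) (s : V → ℕ) (I : Finset V) : |attemptAll δ c f L s I| ≤ C := by
  rw [abs_le]
  constructor
  · rw [← attemptAll_const (δ := δ) c (-C) L s I]
    exact attemptAll_mono h0 h1 c (fun s I => (abs_le.1 (h s I)).1) L s I
  · rw [← attemptAll_const (δ := δ) c C L s I]
    exact attemptAll_mono h0 h1 c (fun s I => (abs_le.1 (h s I)).2) L s I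

theorem abs_expectAfter_le {δ : ℝ} (h0 : 0 ≤ δ) (h1 : δ ≤ 1) (c : ℕ × V → V) {g : Finset V → ℝ}
    {C : ℝ} (h : ∀ I, |g I| ≤ C) (k : ℕ) (s : V → ℕ)
    (I : Finset V) : |expectAfter δ c g k s I| ≤ C := by
  induction k generalizing s I with
  | zero => exact h I
  | succ k ih => exact abs_attemptAll_le h0 h1 c ih _ _ _

theorem expectAfter_nonneg {δ : ℝ} (h0 : 0 ≤ δ) (h1 : δ ≤ 1) (c : ℕ × V → V) {g : Finset V → ℝ}
    (h : ∀ I, 0 ≤ g I) (k : ℕ) (s : V → ℕ)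
    (I : Finset V) : 0 ≤ expectAfter δ c g k s I := by
  induction k generalizing s I with
  | zero => exact h I
  | succ k ih =>
    rw [← attemptAll_const (δ := δ) c 0 I.toList s I]
    exact attemptAll_mono h0 h1 c ih _ _ _

theorem one_sub_attemptAll_le {δ : ℝ} (h0 : 0 ≤ δ) (h1 : δ ≤ 1) (c : ℕ × V → V)
    {W : Type*} [Fintype W] {f : (V → ℕ) → Finset V → ℝ}
    {h : W → (V → ℕ) → Finset V → ℝ} (hf : ∀ s I, 1 - f s I ≤ ∑ w, h w s I)
    (L : List V) (s : V → ℕ) (I : Finset V) :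
    1 - attemptAll δ c f L s I ≤ ∑ w, attemptAll δ c (h w) L s I := by
  classical
  induction L generalizing s I with
  | nil => exact hf s I
  | cons u L ih =>
    simp only [attemptAll, Finset.sum_add_distrib, ← Finset.mul_sum]
    have e1 := mul_le_mul_of_nonneg_left (ih (Function.update s u (s u + 1))
      (insert (c (s u, u)) I)) (sub_nonneg.2 h1)
    have e2 := mul_le_mul_of_nonneg_left (ih s I) h0
    linarith

theorem one_sub_expectAfter_le {δ : ℝ} (h0 : 0 ≤ δ) (h1 : δ ≤ 1) (c : ℕ × V → V)
    {W : Type*} [Fintype W] {g : Finset V → ℝ}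
    {h : W → Finset V → ℝ} (hg : ∀ I, 1 - g I ≤ ∑ w, h w I) (k : ℕ) (s : V → ℕ)
    (I : Finset V) : 1 - expectAfter δ c g k s I ≤ ∑ w, expectAfter δ c (h w) k s I := by
  induction k generalizing s I with
  | zero => exact hg I
  | succ k ih => exact one_sub_attemptAll_le h0 h1 c ih _ _ _

end Bounds

section Law

open Classical in
theorem attemptAll_update (δ : ℝ) {F : (V → ℕ) → Finset V → (ℕ × V → V) → ℝ}
    (hinv : ∀ s I i u x c, i < s u → F s I (Function.update c (i, u) x) = F s I c)
    (L : List V) (s : V → ℕ) (I : Finset V) (i : ℕ) (u x : V) (c : ℕ × V → V) (hi : i < s u) :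
    attemptAll δ (Function.update c (i, u) x)
        (fun s I => F s I (Function.update c (i, u) x)) L s I
      = attemptAll δ c (fun s I => F s I c) L s I := by
  induction L generalizing s I with
  | nil => exact hinv s I i u x c hi
  | cons u' L ih =>
    have hne : (s u', u') ≠ (i, u) := by
      intro h
      simp only [Prod.mk.injEq] at h
      obtain ⟨h1, h2⟩ := h
      subst h2
      omega
    rw [attemptAll, attemptAll, ih s I hi, Function.update_of_ne hne, ih]
    by_cases h : u = u'
    · subst h; simp; omega
    · rwa [Function.update_of_ne h]

open Classical in
theorem expectAfter_update (δ : ℝ) (g : Finset V → ℝ) (k : ℕ) (s : V → ℕ) (I : Finset V) (i : ℕ)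
    (u x : V) (c : ℕ × V → V) (hi : i < s u) :
    expectAfter δ (Function.update c (i, u) x) g k s I = expectAfter δ c g k s I := by
  induction k generalizing s I i u x c with
  | zero => rfl
  | succ k ih =>
    exact attemptAll_update δ (F := fun s I c => expectAfter δ c g k s I)
      (fun s I i u x c h => ih s I i u x c h) _ s I i u x c hi

variable [Fintype V]

open Classical in
/-- The indicator that everybody is informed. -/
noncomputable def allInformed (I : Finset V) : ℝ := if I = Finset.univ then 1 else 0

theorem allInformed_nonneg (I : Finset V) : 0 ≤ allInformed I := by
  unfold allInformed; split_ifs <;> simp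

theorem abs_allInformed_le (I : Finset V) : |allInformed I| ≤ 1 := by
  unfold allInformed; split_ifs <;> simp

variable [MeasurableSpace V] [DiscreteMeasurableSpace V]

theorem measurable_attemptAll (δ : ℝ) {F : (V → ℕ) → Finset V → (ℕ × V → V) → ℝ}
    (hF : ∀ s I, Measurable (F s I)) (L : List V) (s : V → ℕ) (I : Finset V) :
    Measurable (fun c => attemptAll δ c (fun s I => F s I c) L s I) := by
  classical
  induction L generalizing s I with
  | nil => exact hF s I
  | cons u L ih =>
    refine Measurable.add (Measurable.const_mul ?_ _) (Measurable.const_mul (ih s I) _)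
    exact measurable_comp_discrete
      (F := fun x c => attemptAll δ c (fun s I => F s I c) L (Function.update s u (s u + 1))
        (insert x I)) (fun x => ih _ _) (measurable_pi_apply (s u, u))

theorem measurable_expectAfter (δ : ℝ) (g : Finset V → ℝ) (k : ℕ) (s : V → ℕ) (I : Finset V) :
    Measurable (fun c => expectAfter δ c g k s I) := by
  induction k generalizing s I with
  | zero => exact measurable_const
  | succ k ih =>
    exact measurable_attemptAll δ (F := fun s I c => expectAfter δ c g k s I) ih _ s I

theorem integrable_of_abs_le {Ω : Type*} [MeasurableSpace Ω] {P : Measure Ω} [IsFiniteMeasure P]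
    {f : Ω → ℝ} (hf : Measurable f) {C : ℝ} (h : ∀ ω, |f ω| ≤ C) : Integrable f P :=
  Integrable.of_bound hf.aestronglyMeasurable C (Filter.Eventually.of_forall h)

theorem integral_attemptAll (H : SimpleGraph V) {δ : ℝ} (h0 : 0 ≤ δ) (h1 : δ ≤ 1)
    {F : (V → ℕ) → Finset V → (ℕ × V → V) → ℝ} (hF : ∀ s I, Measurable (F s I)) {C : ℝ}
    (hC : ∀ s I c, |F s I c| ≤ C)
    (hinv : ∀ s I i u x c, i < s u → F s I (open Classical in Function.update c (i, u) x) = F s I c)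
    {g : Finset V → ℝ} (hg : ∀ s I, ∫ c, F s I c ∂(pushLaw H) = g I)
    (L : List V) (s : V → ℕ) (I : Finset V) (hL : ∀ u ∈ L, u ∈ I) :
    ∫ c, attemptAll δ c (fun s I => F s I c) L s I ∂(pushLaw H)
      = callAll (lazy δ (callProb H)) g L I := by
  classical
  induction L generalizing s I with
  | nil => exact hg s I
  | cons u L ih =>
    have hL' : ∀ w ∈ L, w ∈ I := fun w hw => hL w (List.mem_cons_of_mem _ hw)
    have hu : u ∈ I := hL u (List.mem_cons_self ..)
    have hbd (s I) (c : ℕ × V → V) : |attemptAll δ c (fun s I => F s I c) L s I| ≤ C :=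
      abs_attemptAll_le h0 h1 c (fun s I => hC s I c) L s I
    have hms (s I) := measurable_attemptAll δ hF L s I
    have key := integral_coordinate_eq_sum (fun i : ℕ × V => callLaw H i.2) (s u, u)
      (A := fun x c => attemptAll δ c (fun s I => F s I c) L (Function.update s u (s u + 1))
        (insert x I)) (fun x => hms _ _) (fun x c => hbd _ _ c) (by
        intro x y c
        exact attemptAll_update δ (by convert hinv) L _ _ (s u) u y c (by simp))
    have hm1 : Measurable (fun c : ℕ × V → V => attemptAll δ c (fun s I => F s I c) L
        (Function.update s u (s u + 1)) (insert (c (s u, u)) I)) :=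
      measurable_comp_discrete
      (F := fun x c => attemptAll δ c (fun s I => F s I c) L (Function.update s u (s u + 1))
        (insert x I)) (fun x => hms _ _) (measurable_pi_apply (s u, u))
    simp only [attemptAll, callAll]
    rw [integral_add ((integrable_of_abs_le hm1 fun c => hbd _ _ c).const_mul _)
      ((integrable_of_abs_le (hms s I) fun c => hbd _ _ c).const_mul _),
      integral_const_mul, integral_const_mul, sum_lazy_mul, ih s I hL', Finset.insert_eq_of_mem hu]
    congr 2
    refine key.trans (Finset.sum_congr rfl fun w _ => ?_)
    rw [← ih (Function.update s u (s u + 1)) (insert w I)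
      fun x hx => Finset.mem_insert_of_mem (hL' x hx)]
    rfl

theorem integral_expectAfter (H : SimpleGraph V) {δ : ℝ} (h0 : 0 ≤ δ) (h1 : δ ≤ 1) (k : ℕ)
    (s : V → ℕ) (I : Finset V) :
    ∫ c, expectAfter δ c allInformed k s I ∂(pushLaw H)
      = successProb (lazy δ (callProb H)) k I := by
  induction k generalizing s I with
  | zero => simp [expectAfter, successProb, allInformed]
  | succ k ih =>
    exact integral_attemptAll H h0 h1 (F := fun s I c => expectAfter δ c allInformed k s I)
      (fun s I => measurable_expectAfter δ _ k s I) (C := 1)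
      (fun s I c => abs_expectAfter_le h0 h1 c abs_allInformed_le k s I)
      (fun s I i u x c h => by
        convert expectAfter_update δ allInformed k s I i u x c h) ih _ _ _
      (fun u hu => Finset.mem_toList.1 hu)

end Law

section Routes

/-- `w` can be reached from the position `a` in the list of `u` within `D` time steps, where every
step moves on in the current list or follows the current call to the beginning of another list. -/
inductive Reaches (c : ℕ × V → V) (w : V) : ℕ → V → ℕ → Prop
  | refl (D a : ℕ) : Reaches c w D w a
  | wait {D : ℕ} {u : V} {a : ℕ} : Reaches c w D u (a + 1) → Reaches c w (D + 1) u a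
  | call {D : ℕ} {u : V} {a : ℕ} : Reaches c w D (c (a, u)) 0 → Reaches c w (D + 1) u a

theorem Reaches.succ {c : ℕ × V → V} {w : V} {D : ℕ} {u : V} {a : ℕ} (h : Reaches c w D u a) :
    Reaches c w (D + 1) u a := by
  induction h with
  | refl D a => exact .refl _ _
  | wait _ ih => exact .wait ih
  | call _ ih => exact .call ih

/-- `w` can be reached within `D` steps from the current state. -/
def HasRoute (c : ℕ × V → V) (s : V → ℕ) (I : Finset V) (D : ℕ) (w : V) : Prop :=
  ∃ u ∈ I, Reaches c w D u (s u)

/-- All vertices that have been called are informed. -/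
def CallsInformed (c : ℕ × V → V) (s : V → ℕ) (I : Finset V) : Prop :=
  ∀ u i, i < s u → c (i, u) ∈ I

theorem CallsInformed.hasRoute {c : ℕ × V → V} {s : V → ℕ} {I : Finset V}
    (hI : CallsInformed c s I) {D : ℕ} {w u : V} {a : ℕ} (h : Reaches c w D u a) (hu : u ∈ I)
    (ha : a ≤ s u) : HasRoute c s I D w := by
  induction h with
  | refl D a => exact ⟨w, hu, .refl _ _⟩
  | @wait D u a h ih =>
    rcases ha.lt_or_eq with ha | rfl
    · obtain ⟨x, hx, hr⟩ := ih hu ha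
      exact ⟨x, hx, hr.succ⟩
    · exact ⟨u, hu, .wait h⟩
  | @call D u a h ih =>
    rcases ha.lt_or_eq with ha | rfl
    · obtain ⟨x, hx, hr⟩ := ih (hI u a ha) (Nat.zero_le _)
      exact ⟨x, hx, hr.succ⟩
    · exact ⟨u, hu, .call h⟩

variable [DecidableEq V]

theorem CallsInformed.attempt {c : ℕ × V → V} {s : V → ℕ} {I : Finset V}
    (hI : CallsInformed c s I) (u : V) :
    CallsInformed c (Function.update s u (s u + 1)) (insert (c (s u, u)) I) := by
  intro x i hi
  by_cases hx : x = u
  · subst hx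
    simp only [Function.update_self] at hi
    rcases Nat.lt_succ_iff_lt_or_eq.1 hi with h | rfl
    · exact Finset.mem_insert_of_mem (hI x i h)
    · exact Finset.mem_insert_self _ _
  · rw [Function.update_of_ne hx] at hi
    exact Finset.mem_insert_of_mem (hI x i hi)

theorem HasRoute.attempt {c : ℕ × V → V} {s : V → ℕ} {I : Finset V}
    (hI : CallsInformed c s I) {D : ℕ} {w : V} (h : HasRoute c s I D w) (u : V) :
    HasRoute c (Function.update s u (s u + 1)) (insert (c (s u, u)) I) D w := by
  obtain ⟨x, hx, hr⟩ := h
  refine (hI.attempt u).hasRoute hr (Finset.mem_insert_of_mem hx) ?_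
  by_cases h : x = u
  · subst h; simp
  · rw [Function.update_of_ne h]

theorem Reaches.attempt {c : ℕ × V → V} {s : V → ℕ} {I : Finset V}
    (hI : CallsInformed c s I) {D : ℕ} {w u : V} (hu : u ∈ I) (h : Reaches c w (D + 1) u (s u)) :
    HasRoute c (Function.update s u (s u + 1)) (insert (c (s u, u)) I) D w := by
  have hI' := hI.attempt u
  generalize hE : D + 1 = E at h
  generalize ha : s u = a at h
  cases h with
  | refl => exact ⟨w, Finset.mem_insert_of_mem hu, .refl _ _⟩
  | wait h =>
    obtain rfl : D = _ := Nat.succ.inj hE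
    subst ha
    exact ⟨u, Finset.mem_insert_of_mem hu, by rwa [Function.update_self]⟩
  | call h =>
    obtain rfl : D = _ := Nat.succ.inj hE
    subst ha
    exact hI'.hasRoute h (Finset.mem_insert_self _ _) (Nat.zero_le _)

end Routes

section Delay

open Classical in
/-- The indicator that `w` is not informed. -/
noncomputable def missed (w : V) (I : Finset V) : ℝ := if w ∈ I then 0 else 1

theorem missed_le_one (w : V) (I : Finset V) : missed w I ≤ 1 := by
  unfold missed; split_ifs <;> simp

theorem one_sub_allInformed_le [Fintype V] (I : Finset V) : 1 - allInformed I ≤ ∑ w, missed w I := by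
  have hnn : ∀ w ∈ Finset.univ, 0 ≤ missed w I := fun w _ => by
    unfold missed; split_ifs <;> simp
  by_cases h : I = Finset.univ
  · simpa [allInformed, h] using Finset.sum_nonneg (h ▸ hnn)
  · obtain ⟨w, hw⟩ : ∃ w, w ∉ I := by
      by_contra hc
      push Not at hc
      exact h (Finset.eq_univ_iff_forall.2 hc)
    have := Finset.single_le_sum hnn (Finset.mem_univ w)
    rw [missed, if_neg hw] at this
    simpa [allInformed, h] using this

theorem attemptAll_eq_zero {δ : ℝ} {c : ℕ × V → V} {f : (V → ℕ) → Finset V → ℝ} {w : V}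
    (hf : ∀ s I, w ∈ I → f s I = 0) (L : List V) (s : V → ℕ) (I : Finset V) (hw : w ∈ I) :
    attemptAll δ c f L s I = 0 := by
  classical
  induction L generalizing s I with
  | nil => exact hf s I hw
  | cons u L ih => rw [attemptAll, ih _ _ hw, ih _ _ (Finset.mem_insert_of_mem hw)]; ring

theorem expectAfter_missed_eq_zero {δ : ℝ} {c : ℕ × V → V} {w : V} (k : ℕ) (s : V → ℕ)
    (I : Finset V) (hw : w ∈ I) : expectAfter δ c (missed w) k s I = 0 := by
  induction k generalizing s I with
  | zero => simp [expectAfter, missed, hw]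
  | succ k ih => exact attemptAll_eq_zero ih _ s I hw

open Classical in
theorem attemptAll_le_of_hasRoute {δ : ℝ} (h0 : 0 ≤ δ) (h1 : δ ≤ 1) {c : ℕ × V → V}
    {f : (V → ℕ) → Finset V → ℝ} {D : ℕ} {w : V} {b : ℝ}
    (hf : ∀ s I, CallsInformed c s I → HasRoute c s I D w → f s I ≤ b)
    (L : List V) (s : V → ℕ) (I : Finset V) (hI : CallsInformed c s I) (h : HasRoute c s I D w) :
    attemptAll δ c f L s I ≤ b := by
  induction L generalizing s I with
  | nil => exact hf s I hI h
  | cons u L ih =>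
    have e1 := mul_le_mul_of_nonneg_left (ih _ _ (hI.attempt u) (h.attempt hI u))
      (sub_nonneg.2 h1)
    have e2 := mul_le_mul_of_nonneg_left (ih s I hI h) h0
    rw [attemptAll]
    linarith

open Classical in
theorem attemptAll_le_of_reaches {δ : ℝ} (h0 : 0 ≤ δ) (h1 : δ ≤ 1) {c : ℕ × V → V}
    {f : (V → ℕ) → Finset V → ℝ} {D : ℕ} {w : V} {b b' : ℝ}
    (hf : ∀ s I, CallsInformed c s I → HasRoute c s I D w → f s I ≤ b)
    (hf' : ∀ s I, CallsInformed c s I → HasRoute c s I (D + 1) w → f s I ≤ b')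
    (L : List V) (s : V → ℕ) (I : Finset V) (hI : CallsInformed c s I) {u : V} (hu : u ∈ I)
    (huL : u ∈ L) (h : Reaches c w (D + 1) u (s u)) :
    attemptAll δ c f L s I ≤ (1 - δ) * b + δ * b' := by
  induction L generalizing s I with
  | nil => simp at huL
  | cons x L ih =>
    rw [attemptAll]
    by_cases hx : u = x
    · subst hx
      exact add_le_add
        (mul_le_mul_of_nonneg_left (attemptAll_le_of_hasRoute h0 h1 hf L _ _ (hI.attempt u)
          (h.attempt hI hu)) (sub_nonneg.2 h1))
        (mul_le_mul_of_nonneg_left (attemptAll_le_of_hasRoute h0 h1 hf' L _ _ hI ⟨u, hu, h⟩) h0)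
    · have huL' : u ∈ L := (List.mem_cons.1 huL).resolve_left hx
      have e1 := mul_le_mul_of_nonneg_left (ih (Function.update s x (s x + 1)) _ (hI.attempt x)
        (Finset.mem_insert_of_mem hu) huL' (by rwa [Function.update_of_ne hx]))
        (sub_nonneg.2 h1)
      have e2 := mul_le_mul_of_nonneg_left (ih s I hI hu huL' h) h0
      linarith

theorem expectAfter_missed_le {δ : ℝ} (h0 : 0 ≤ δ) (h1 : δ ≤ 1) {M : ℝ} (hM : 1 ≤ M)
    {c : ℕ × V → V} {w : V} (k : ℕ) (s : V → ℕ) (I : Finset V) (hI : CallsInformed c s I) (D : ℕ)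
    (h : HasRoute c s I D w) :
    expectAfter δ c (missed w) k s I ≤ (δ + (1 - δ) / M) ^ k * M ^ D := by
  have hM0 : 0 < M := by linarith
  have hq : 0 ≤ δ + (1 - δ) / M := add_nonneg h0 (div_nonneg (by linarith) hM0.le)
  induction k generalizing s I D with
  | zero =>
    rw [pow_zero, one_mul]
    exact (missed_le_one w I).trans (one_le_pow₀ hM)
  | succ k ih =>
    cases D with
    | zero =>
      obtain ⟨u, hu, hr⟩ := h
      cases hr
      rw [expectAfter_missed_eq_zero _ _ _ hu]
      positivity
    | succ D =>
      obtain ⟨u, hu, hr⟩ := h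
      refine (attemptAll_le_of_reaches h0 h1 (fun s I hI h => ih s I hI D h)
        (fun s I hI h => ih s I hI (D + 1) h) I.toList s I hI hu (Finset.mem_toList.2 hu)
        hr).trans (le_of_eq ?_)
      rw [pow_succ, pow_succ]
      field_simp
      ring

end Delay

section NoDelay

open Classical in
theorem exists_of_attemptAll_zero_ne_zero {c : ℕ × V → V} {f : (V → ℕ) → Finset V → ℝ} {v w : V}
    {t : ℕ} (L : List V) (hL : L.Nodup) (s : V → ℕ) (I : Finset V) (hLI : ∀ u ∈ L, u ∈ I)
    (hs : ∀ x, x ∉ I → s x = 0)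
    (hI : ∀ x ∈ I, ∀ D, Reaches c w D x (s x) → Reaches c w (D + (t + 1)) v 0)
    (hIL : ∀ x ∈ L, ∀ D, Reaches c w D x (s x) → Reaches c w (D + t) v 0)
    (h : attemptAll 0 c f L s I ≠ 0) :
    ∃ s' I', f s' I' ≠ 0 ∧ (∀ x, x ∉ I' → s' x = 0) ∧
      ∀ x ∈ I', ∀ D, Reaches c w D x (s' x) → Reaches c w (D + (t + 1)) v 0 := by
  induction L generalizing s I with
  | nil => exact ⟨s, I, h, hs, hI⟩
  | cons u L ih =>
    simp only [attemptAll, sub_zero, one_mul, zero_mul, add_zero] at h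
    have hu : u ∈ I := hLI u (List.mem_cons_self ..)
    have huL : u ∉ L := (List.nodup_cons.1 hL).1
    refine ih (List.nodup_cons.1 hL).2 _ _
      (fun x hx => Finset.mem_insert_of_mem (hLI x (List.mem_cons_of_mem _ hx))) ?_ ?_ ?_ h
    · intro x hx
      rw [Finset.mem_insert, not_or] at hx
      rw [Function.update_of_ne (fun h : x = u => hx.2 (h ▸ hu))]
      exact hs x hx.2
    · intro x hx D hr
      by_cases hxu : x = u
      · subst hxu
        rw [Function.update_self] at hr
        rw [Nat.add_comm t 1, ← Nat.add_assoc]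
        exact hIL x (List.mem_cons_self ..) (D + 1) (.wait hr)
      · rw [Function.update_of_ne hxu] at hr
        by_cases hxI : x ∈ I
        · exact hI x hxI D hr
        · obtain rfl : x = c (s u, u) := (Finset.mem_insert.1 hx).resolve_right hxI
          rw [hs _ hxI] at hr
          rw [Nat.add_comm t 1, ← Nat.add_assoc]
          exact hIL u (List.mem_cons_self ..) (D + 1) (.call hr)
    · intro x hx D hr
      rw [Function.update_of_ne (fun h : x = u => huL (h ▸ hx))] at hr
      exact hIL x (List.mem_cons_of_mem _ hx) D hr

variable [Fintype V]

theorem reaches_of_expectAfter_zero_ne_zero {c : ℕ × V → V} {v w : V} (k t : ℕ) (s : V → ℕ)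
    (I : Finset V) (hs : ∀ x, x ∉ I → s x = 0)
    (hI : ∀ x ∈ I, ∀ D, Reaches c w D x (s x) → Reaches c w (D + t) v 0)
    (h : expectAfter 0 c allInformed k s I ≠ 0) : Reaches c w (k + t) v 0 := by
  induction k generalizing t s I with
  | zero =>
    have hI' : I = Finset.univ := by
      by_contra hc
      exact h (if_neg hc)
    exact hI w (hI' ▸ Finset.mem_univ w) 0 (.refl _ _)
  | succ k ih =>
    obtain ⟨s', I', h', hs', hI'⟩ := exists_of_attemptAll_zero_ne_zero I.toList I.nodup_toList s I
      (fun u hu => Finset.mem_toList.1 hu) hs (fun x hx D hr => (hI x hx D hr).succ)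
      (fun x hx => hI x (Finset.mem_toList.1 hx)) h
    rw [Nat.add_assoc, Nat.add_comm 1]
    exact ih (t + 1) s' I' hs' hI' h'

theorem one_sub_expectAfter_le_add {δ : ℝ} (h0 : 0 ≤ δ) (h1 : δ ≤ 1) {M : ℝ} (hM : 1 ≤ M)
    (c : ℕ × V → V) (v : V) (m m' : ℕ) :
    1 - expectAfter δ c allInformed m' 0 {v} ≤
      Fintype.card V * ((δ + (1 - δ) / M) ^ m' * M ^ m)
        + (1 - expectAfter 0 c allInformed m 0 {v}) := by
  have hle := (abs_le.1 (abs_expectAfter_le le_rfl zero_le_one c abs_allInformed_le m 0 {v})).2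
  have hpos := expectAfter_nonneg h0 h1 c allInformed_nonneg m' 0 {v}
  have hq : 0 ≤ δ + (1 - δ) / M := add_nonneg h0 (div_nonneg (by linarith) (by linarith))
  by_cases h : expectAfter 0 c allInformed m 0 {v} = 0
  · rw [h]
    have : 0 ≤ Fintype.card V * ((δ + (1 - δ) / M) ^ m' * M ^ m) := by positivity
    linarith
  · have hreach (w : V) : HasRoute c 0 {v} m w :=
      ⟨v, Finset.mem_singleton_self v, reaches_of_expectAfter_zero_ne_zero m 0 0 {v}
        (fun _ _ => rfl) (fun x hx D hr => by rwa [Finset.mem_singleton.1 hx] at hr) h⟩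
    have hsum := one_sub_expectAfter_le h0 h1 c one_sub_allInformed_le m' 0 {v}
    have hb : ∑ w, expectAfter δ c (missed w) m' 0 {v}
        ≤ ∑ _w : V, (δ + (1 - δ) / M) ^ m' * M ^ m :=
      Finset.sum_le_sum fun w _ => expectAfter_missed_le h0 h1 hM m' 0 {v}
        (fun u i hi => absurd hi (Nat.not_lt_zero i)) m (hreach w)
    rw [Finset.sum_const, nsmul_eq_mul, Finset.card_univ] at hb
    linarith

variable [MeasurableSpace V] [DiscreteMeasurableSpace V]

/-- Dropping calls with a small probability does not slow down the push protocol much. -/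
theorem successProb_lazy_ge (H : SimpleGraph V) {δ : ℝ} (h0 : 0 ≤ δ) (h1 : δ ≤ 1) {M : ℝ}
    (hM : 1 ≤ M) (v : V) (m m' : ℕ) :
    successProb (callProb H) m {v} - Fintype.card V * ((δ + (1 - δ) / M) ^ m' * M ^ m)
      ≤ successProb (lazy δ (callProb H)) m' {v} := by
  have hint (δ : ℝ) (h0 : 0 ≤ δ) (h1 : δ ≤ 1) (k : ℕ) :
      Integrable (fun c => expectAfter δ c allInformed k 0 {v}) (pushLaw H) :=
    integrable_of_abs_le (measurable_expectAfter δ _ k 0 {v})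
      fun c => abs_expectAfter_le h0 h1 c abs_allInformed_le k 0 {v}
  have e := integral_expectAfter H le_rfl zero_le_one m 0 {v}
  rw [lazy_zero] at e
  rw [← e, ← integral_expectAfter H h0 h1 m' 0 {v}]
  have := integral_mono ((hint 0 le_rfl zero_le_one m).sub (integrable_const _)) (hint δ h0 h1 m')
    (fun c => show expectAfter 0 c allInformed m 0 {v}
      - Fintype.card V * ((δ + (1 - δ) / M) ^ m' * M ^ m) ≤ _ by
        linarith [one_sub_expectAfter_le_add h0 h1 hM c v m m'])
  rw [integral_sub' (hint 0 le_rfl zero_le_one m) (integrable_const _)] at this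
  simpa using this

end NoDelay

end Asynchronous

section CallProb

variable {V : Type*} [MeasurableSpace V]

theorem callProb_nonneg (H : SimpleGraph V) (u w : V) : 0 ≤ callProb H u w := measureReal_nonneg

theorem callProb_congr {H H' : SimpleGraph V} {u : V} (h : H.neighborSet u = H'.neighborSet u)
    (w : V) : callProb H u w = callProb H' u w := by
  rw [callProb, callProb, callLaw, callLaw, h]

variable [Fintype V] [DiscreteMeasurableSpace V]

theorem sum_callProb (H : SimpleGraph V) (u : V) : ∑ w, callProb H u w = 1 := by
  classical
  simp only [callProb, sum_measureReal_singleton]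
  simp

theorem callProb_of_adj {H : SimpleGraph V} {u w : V} (h : H.Adj u w) :
    callProb H u w = 1 / ((H.neighborSet u).ncard : ℝ) := by
  classical
  have hne : (H.neighborSet u).Nonempty := ⟨w, h⟩
  have hf := Set.toFinite (H.neighborSet u)
  rw [callProb, callLaw, if_pos hne, measureReal_def, ← hf.coe_toFinset, ← Finset.coe_singleton,
    ProbabilityTheory.uniformOn_apply_finset, Finset.inter_singleton_of_mem (by simpa using h)]
  simp [Set.ncard_eq_toFinset_card _ hf]

theorem callProb_of_not_adj {H : SimpleGraph V} {u w : V} (hne : (H.neighborSet u).Nonempty)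
    (h : ¬ H.Adj u w) : callProb H u w = 0 := by
  classical
  have hf := Set.toFinite (H.neighborSet u)
  rw [callProb, callLaw, if_pos hne, measureReal_def, ← hf.coe_toFinset, ← Finset.coe_singleton,
    ProbabilityTheory.uniformOn_apply_finset, Finset.inter_singleton_of_notMem (by simpa using h)]
  simp

end CallProb

section Edge

variable {V : Type*}

theorem neighborSet_sup_edge {H : SimpleGraph V} {u w : V} (hne : u ≠ w) :
    (H ⊔ SimpleGraph.edge u w).neighborSet u = insert w (H.neighborSet u) := by
  ext x
  simp only [SimpleGraph.mem_neighborSet, SimpleGraph.sup_adj, SimpleGraph.edge_adj,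
    Set.mem_insert_iff]
  grind

theorem neighborSet_sup_edge_of_ne {H : SimpleGraph V} {u w x : V} (hu : x ≠ u) (hw : x ≠ w) :
    (H ⊔ SimpleGraph.edge u w).neighborSet x = H.neighborSet x := by
  ext y
  simp only [SimpleGraph.mem_neighborSet, SimpleGraph.sup_adj, SimpleGraph.edge_adj]
  grind

variable [Fintype V]

theorem ncard_neighborSet_sup_edge {H : SimpleGraph V} {u w : V} (hne : u ≠ w)
    (h : ¬ H.Adj u w) :
    ((H ⊔ SimpleGraph.edge u w).neighborSet u).ncard = (H.neighborSet u).ncard + 1 := by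
  rw [neighborSet_sup_edge hne, Set.ncard_insert_of_notMem (by simpa using h) (Set.toFinite _)]

open Classical in
theorem sum_eq_sum_not_adj (u w : V) (hne : u ≠ w) (g : SimpleGraph V → ℝ) :
    ∑ H, g H = ∑ H with ¬ H.Adj u w, (g H + g (H ⊔ SimpleGraph.edge u w)) := by
  rw [Finset.sum_add_distrib, ← Finset.sum_filter_not_add_sum_filter _ (fun H => H.Adj u w)]
  congr 1
  symm
  refine Finset.sum_nbij' (fun H => H ⊔ SimpleGraph.edge u w)
    (fun H => H \ SimpleGraph.edge u w) ?_ ?_ ?_ ?_ (fun _ _ => rfl)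
  · intro H _
    simp [SimpleGraph.edge_adj, hne]
  · intro H _
    simp [SimpleGraph.edge_adj, hne]
  · intro H hH
    simp only [Finset.mem_filter, Finset.mem_univ, true_and] at hH
    ext x y
    simp only [SimpleGraph.sdiff_adj, SimpleGraph.sup_adj, SimpleGraph.edge_adj]
    have := H.adj_comm u w
    grind
  · intro H hH
    simp only [Finset.mem_filter, Finset.mem_univ, true_and] at hH
    ext x y
    simp only [SimpleGraph.sdiff_adj, SimpleGraph.sup_adj, SimpleGraph.edge_adj]
    have := H.adj_comm u w
    grind

end Edge

section Annealed

variable {V : Type*} [Fintype V]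

/-- The weights `W` do not decrease much when an edge of `G` from `u` to an uninformed vertex is
added; the loss is at most a factor `ρ` for every call that `u` has made. -/
def EdgeWeightBound (G : SimpleGraph V) (p ρ A : ℝ) (W : SimpleGraph V → ℝ) (I : Finset V)
    (j : V → ℕ) : Prop :=
  ∀ u w, G.Adj u w → w ∉ I → ∀ H : SimpleGraph V, ¬ H.Adj u w →
    A ≤ (H.neighborSet u).ncard →
    p * ρ ^ j u * W H ≤ (1 - p) * W (H ⊔ SimpleGraph.edge u w)

open Classical in
/-- The indicator that some degree is outside `[A + 1, B - 1]`. -/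
noncomputable def irregular (A B : ℝ) (H : SimpleGraph V) : ℝ :=
  if ∀ u, A + 1 ≤ (H.neighborSet u).ncard ∧ (H.neighborSet u).ncard + 1 ≤ B then 0 else 1

theorem irregular_nonneg (A B : ℝ) (H : SimpleGraph V) : 0 ≤ irregular A B H := by
  unfold irregular; split_ifs <;> simp

theorem irregular_le_one (A B : ℝ) (H : SimpleGraph V) : irregular A B H ≤ 1 := by
  unfold irregular; split_ifs <;> simp

theorem one_sub_irregular_eq_zero {A B : ℝ} {H : SimpleGraph V} (u : V)
    (h : ¬ (A + 1 ≤ (H.neighborSet u).ncard ∧ (H.neighborSet u).ncard + 1 ≤ B)) :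
    1 - irregular A B H = 0 := by
  rw [irregular, if_neg fun hc => h (hc u), sub_self]

variable [MeasurableSpace V] [DiscreteMeasurableSpace V]

open Classical in
theorem EdgeWeightBound.call {G : SimpleGraph V} {p ρ A : ℝ} {W : SimpleGraph V → ℝ}
    {I : Finset V} {j : V → ℕ} (h : EdgeWeightBound G p ρ A W I j) (hp1 : p ≤ 1)
    (hW : ∀ H, 0 ≤ W H) (hρ0 : 0 ≤ ρ) (hA : 1 ≤ A) (hρ : ρ * (A + 1) ≤ A) {u : V} (hu : u ∈ I)
    (x : V) :
    EdgeWeightBound G p ρ A (fun H => W H * callProb H u x) (insert x I)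
      (Function.update j u (j u + 1)) := by
  intro y w hG hw H hH hd
  rw [Finset.mem_insert, not_or] at hw
  have hwu : u ≠ w := fun h => hw.2 (h ▸ hu)
  have hyw : y ≠ w := hG.ne
  have key := h y w hG hw.2 H hH hd
  by_cases hy : y = u
  · subst hy
    rw [Function.update_self]
    have hpos : (0 : ℝ) < (H.neighborSet y).ncard := by linarith
    have hne : (H.neighborSet y).Nonempty := by
      rw [← Set.ncard_pos]; exact_mod_cast hpos
    have hne' : ((H ⊔ SimpleGraph.edge y w).neighborSet y).Nonempty := by
      rw [neighborSet_sup_edge hyw]; exact Set.insert_nonempty _ _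
    have hadj : (H ⊔ SimpleGraph.edge y w).Adj y x ↔ H.Adj y x := by
      have := Set.ext_iff.1 (neighborSet_sup_edge (H := H) hyw) x
      simp only [SimpleGraph.mem_neighborSet, Set.mem_insert_iff] at this
      rw [this]
      exact or_iff_right (Ne.symm hw.1)
    have hratio : ρ * callProb H y x ≤ callProb (H ⊔ SimpleGraph.edge y w) y x := by
      by_cases hx : H.Adj y x
      · rw [callProb_of_adj hx, callProb_of_adj (hadj.2 hx),
          ncard_neighborSet_sup_edge hyw hH, Nat.cast_add, Nat.cast_one, mul_one_div,
          div_le_div_iff₀ hpos (by linarith)]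
        have hρ1 : ρ ≤ 1 := by nlinarith
        nlinarith
      · rw [callProb_of_not_adj hne hx, callProb_of_not_adj hne' (fun h => hx (hadj.1 h)), mul_zero]
    calc p * ρ ^ (j y + 1) * (W H * callProb H y x)
        = (p * ρ ^ j y * W H) * (ρ * callProb H y x) := by ring
      _ ≤ ((1 - p) * W (H ⊔ SimpleGraph.edge y w))
            * callProb (H ⊔ SimpleGraph.edge y w) y x :=
          mul_le_mul key hratio (mul_nonneg hρ0 (callProb_nonneg _ _ _))
            (mul_nonneg (by linarith) (hW _))
      _ = _ := by ring
  · beta_reduce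
    rw [Function.update_of_ne hy, callProb_congr (H := H ⊔ _)
      (neighborSet_sup_edge_of_ne (Ne.symm hy) hwu)]
    have := mul_le_mul_of_nonneg_right key (callProb_nonneg H u x)
    linarith

open Classical in
theorem EdgeWeightBound.le_sum_callProb {G : SimpleGraph V} {p ρ A B : ℝ} {W : SimpleGraph V → ℝ}
    {I : Finset V} {j : V → ℕ} (h : EdgeWeightBound G p ρ A W I j) (hp0 : 0 ≤ p)
    (hW : ∀ H, 0 ≤ W H) (hρ0 : 0 ≤ ρ) (hρ1 : ρ ≤ 1) (hB : 0 < B) {u w : V}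
    (hG : G.Adj u w) (hw : w ∉ I) :
    p * ρ ^ j u / B * ∑ H, W H * (1 - irregular A B H) ≤ ∑ H, W H * callProb H u w := by
  have hne := hG.ne
  rw [sum_eq_sum_not_adj u w hne, sum_eq_sum_not_adj u w hne, Finset.mul_sum]
  refine Finset.sum_le_sum fun H hH => ?_
  simp only [Finset.mem_filter, Finset.mem_univ, true_and] at hH
  set H' := H ⊔ SimpleGraph.edge u w with hH'
  have hd : ((H'.neighborSet u).ncard : ℝ) = (H.neighborSet u).ncard + 1 := by
    rw [hH', ncard_neighborSet_sup_edge hne hH]; push_cast; rfl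
  have hadj : H'.Adj u w := by simp [hH', SimpleGraph.edge_adj, hne]
  have hpow : 0 ≤ ρ ^ j u := pow_nonneg hρ0 _
  have hpow1 : ρ ^ j u ≤ 1 := pow_le_one₀ hρ0 hρ1
  have hn1 : 0 ≤ W H * callProb H u w := mul_nonneg (hW _) (callProb_nonneg _ _ _)
  have hn2 : 0 ≤ W H' * callProb H' u w := mul_nonneg (hW _) (callProb_nonneg _ _ _)
  by_cases hc : A ≤ (H.neighborSet u).ncard ∧ ((H.neighborSet u).ncard : ℝ) + 1 ≤ B
  · have e1 := h u w hG hw H hH hc.1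
    have e2 : p * ρ ^ j u * W H' ≤ p * W H' := by
      have := mul_le_mul_of_nonneg_left hpow1 (mul_nonneg hp0 (hW H'))
      linarith
    have i1 : W H * (1 - irregular A B H) ≤ W H :=
      mul_le_of_le_one_right (hW H) (by linarith [irregular_nonneg A B H])
    have i2 : W H' * (1 - irregular A B H') ≤ W H' :=
      mul_le_of_le_one_right (hW H') (by linarith [irregular_nonneg A B H'])
    have e3 : p * ρ ^ j u * (W H * (1 - irregular A B H) + W H' * (1 - irregular A B H'))
        ≤ W H' := by
      have := mul_le_mul_of_nonneg_left (add_le_add i1 i2) (mul_nonneg hp0 hpow)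
      linarith
    have e4 : W H' / B ≤ W H' * callProb H' u w := by
      rw [callProb_of_adj hadj, hd, div_eq_mul_one_div]
      refine mul_le_mul_of_nonneg_left (one_div_le_one_div_of_le ?_ hc.2) (hW _)
      positivity
    calc _ = p * ρ ^ j u * (W H * (1 - irregular A B H) + W H' * (1 - irregular A B H')) / B := by
          ring
      _ ≤ W H' / B := by gcongr
      _ ≤ _ := by linarith
  · rw [one_sub_irregular_eq_zero (H := H) u (fun h => hc ⟨by linarith [h.1], h.2⟩),
      one_sub_irregular_eq_zero (H := H') u (by
        rw [hd]; exact fun h => hc ⟨by linarith [h.1], by linarith [h.2]⟩)]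
    simp only [mul_zero, add_zero]
    linarith

open Classical in
theorem sum_weight_callProb (W : SimpleGraph V → ℝ) (u : V) :
    ∑ w, ∑ H, W H * callProb H u w = ∑ H, W H := by
  rw [Finset.sum_comm]
  refine Finset.sum_congr rfl fun H _ => ?_
  rw [← Finset.mul_sum, sum_callProb, mul_one]

open Classical in
/-- One call: averaged over the weights `W`, the calls of `u` are at least as good as those of the
lazy protocol on `G`, up to the weight of the irregular graphs. -/
theorem sum_weight_call_ge {G : SimpleGraph V} {p ρ A B δ : ℝ} {d m : ℕ}
    (hp0 : 0 ≤ p) (hρ0 : 0 ≤ ρ) (hρ1 : ρ ≤ 1)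
    (hB : 0 < B) (hd : 0 < d)
    (hG : ∀ u, (G.neighborSet u).ncard = d) (hβ : (1 - δ) / d ≤ p * ρ ^ m / B)
    {W : SimpleGraph V → ℝ} {I : Finset V} {j : V → ℕ} (h : EdgeWeightBound G p ρ A W I j)
    (hW : ∀ H, 0 ≤ W H) {u : V} (hu : u ∈ I) (hj : j u ≤ m) {F : Finset V → ℝ} (hF : Monotone F)
    (hF0 : ∀ I, 0 ≤ F I)
    (hF1 : ∑ w, lazy δ (callProb G) u w * F (insert w I) ≤ 1) :
    (∑ H, W H) * (∑ w, lazy δ (callProb G) u w * F (insert w I)) - ∑ H, W H * irregular A B H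
      ≤ ∑ w, (∑ H, W H * callProb H u w) * F (insert w I) := by
  set Q := ∑ H, W H with hQ
  set R := ∑ H, W H * irregular A B H with hR
  have hR0 : 0 ≤ R := Finset.sum_nonneg fun H _ => mul_nonneg (hW H) (irregular_nonneg A B H)
  have hQR : ∑ H, W H * (1 - irregular A B H) = Q - R := by
    rw [hQ, hR, ← Finset.sum_sub_distrib]
    exact Finset.sum_congr rfl fun H _ => by ring
  have hQR0 : 0 ≤ Q - R := by
    rw [← hQR]
    exact Finset.sum_nonneg fun H _ =>
      mul_nonneg (hW H) (by linarith [irregular_le_one A B H])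
  have hQw (w) : 0 ≤ ∑ H, W H * callProb H u w :=
    Finset.sum_nonneg fun H _ => mul_nonneg (hW H) (callProb_nonneg H u w)
  have hterm (w) : (1 - δ) * callProb G u w * (Q - R) * (F (insert w I) - F I)
      ≤ (∑ H, W H * callProb H u w) * (F (insert w I) - F I) := by
    have hF' : 0 ≤ F (insert w I) - F I := sub_nonneg.2 (hF (Finset.subset_insert w I))
    by_cases hw : w ∈ I
    · simp [Finset.insert_eq_of_mem hw]
    refine mul_le_mul_of_nonneg_right ?_ hF'
    by_cases hadj : G.Adj u w
    · have hlow := h.le_sum_callProb (B := B) hp0 hW hρ0 hρ1 hB hadj hw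
      rw [hQR] at hlow
      refine le_trans (mul_le_mul_of_nonneg_right ?_ hQR0) hlow
      rw [callProb_of_adj hadj, hG u, mul_one_div]
      refine hβ.trans ?_
      have := pow_le_pow_of_le_one hρ0 hρ1 hj
      gcongr
    · have hne : (G.neighborSet u).Nonempty := by rw [← Set.ncard_pos, hG u]; exact hd
      rw [callProb_of_not_adj hne hadj, mul_zero, zero_mul]
      exact hQw w
  have hsum := Finset.sum_le_sum fun w (_ : w ∈ Finset.univ) => hterm w
  have hr : ∑ w, (∑ H, W H * callProb H u w) * (F (insert w I) - F I)
      = ∑ w, (∑ H, W H * callProb H u w) * F (insert w I) - Q * F I := by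
    simp only [mul_sub, Finset.sum_sub_distrib]
    rw [← Finset.sum_mul, sum_weight_callProb]
  have hl : ∑ w, (1 - δ) * callProb G u w * (Q - R) * (F (insert w I) - F I)
      = (Q - R) * ((1 - δ) * ∑ w, callProb G u w * F (insert w I) - (1 - δ) * F I) := by
    have h1 : ∑ w, callProb G u w * F I = F I := by rw [← Finset.sum_mul, sum_callProb, one_mul]
    clear_value Q R
    calc _ = (Q - R) * ((1 - δ) * ∑ w, callProb G u w * F (insert w I)
            - (1 - δ) * ∑ w, callProb G u w * F I) := by
          rw [Finset.mul_sum, Finset.mul_sum, ← Finset.sum_sub_distrib, Finset.mul_sum]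
          exact Finset.sum_congr rfl fun w _ => by ring
      _ = _ := by rw [h1]
  rw [hr, hl] at hsum
  have hlz := sum_lazy_mul δ (callProb G) u fun w => F (insert w I)
  simp only [Finset.insert_eq_of_mem hu] at hlz
  rw [hlz] at hF1 ⊢
  have hFI := hF0 I
  have : R * ((1 - δ) * ∑ w, callProb G u w * F (insert w I) + δ * F I - F I) ≤ R * 1 :=
    mul_le_mul_of_nonneg_left (by linarith) hR0
  linarith

open Classical in
theorem sum_weight_callAll_ge {G : SimpleGraph V} {p ρ A B δ : ℝ} {d m : ℕ}
    (hp0 : 0 ≤ p) (hp1 : p ≤ 1) (hρ0 : 0 ≤ ρ) (hA : 1 ≤ A) (hρ : ρ * (A + 1) ≤ A)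
    (hB : 0 < B) (hδ0 : 0 ≤ δ) (hδ1 : δ ≤ 1) (hd : 0 < d)
    (hG : ∀ u, (G.neighborSet u).ncard = d) (hβ : (1 - δ) / d ≤ p * ρ ^ m / B)
    {f : SimpleGraph V → Finset V → ℝ} {g : Finset V → ℝ} (hg : Monotone g)
    (hg0 : ∀ I, 0 ≤ g I) (hg1 : ∀ I, g I ≤ 1) {k e : ℕ}
    (hfg : ∀ (W : SimpleGraph V → ℝ) (I : Finset V) (j : V → ℕ), (∀ H, 0 ≤ W H) →
      EdgeWeightBound G p ρ A W I j → (∀ u, j u + k ≤ m) →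
      (∑ H, W H) * g I - e * ∑ H, W H * irregular A B H ≤ ∑ H, W H * f H I)
    (L : List V) (W : SimpleGraph V → ℝ) (I : Finset V) (j : V → ℕ) (hW : ∀ H, 0 ≤ W H)
    (h : EdgeWeightBound G p ρ A W I j) (hj : ∀ u, j u + L.count u + k ≤ m)
    (hL : ∀ u ∈ L, u ∈ I) :
    (∑ H, W H) * callAll (lazy δ (callProb G)) g L I
        - (e + L.length : ℕ) * ∑ H, W H * irregular A B H
      ≤ ∑ H, W H * callAll (callProb H) (f H) L I := by
  have hρ1 : ρ ≤ 1 := by nlinarith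
  have hlz0 := lazy_nonneg hδ0 hδ1 (callProb_nonneg G)
  have hlz1 : ∀ u, ∑ w, lazy δ (callProb G) u w = 1 := sum_lazy (sum_callProb G)
  induction L generalizing W I j with
  | nil => exact hfg W I j hW h (by simpa using hj)
  | cons u L ih =>
    have hu : u ∈ I := hL u (List.mem_cons_self ..)
    have hju : j u ≤ m := by have := hj u; omega
    have hstep := sum_weight_call_ge hp0 hρ0 hρ1 hB hd hG hβ h hW hu hju
      (callAll_mono hlz0 hg L) (callAll_nonneg hlz0 hg0 L)
      (callAll_le_one hlz0 hlz1 hg1 (u :: L) I)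
    have hw (w : V) := ih (fun H => W H * callProb H u w) (insert w I)
      (Function.update j u (j u + 1)) (fun H => mul_nonneg (hW H) (callProb_nonneg H u w))
      (h.call hp1 hW hρ0 hA hρ hu w) (by
        intro x
        have := hj x
        by_cases hx : x = u
        · subst hx
          rw [List.count_cons_self] at this
          rw [Function.update_self]
          omega
        · rw [List.count_cons_of_ne (Ne.symm hx)] at this
          rwa [Function.update_of_ne hx])
      (fun x hx => Finset.mem_insert_of_mem (hL x (List.mem_cons_of_mem _ hx)))
    have hsum := Finset.sum_le_sum fun w (_ : w ∈ Finset.univ) => hw w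
    rw [Finset.sum_sub_distrib, ← Finset.mul_sum] at hsum
    have e1 : ∑ w, ∑ H, W H * callProb H u w * irregular A B H
        = ∑ H, W H * irregular A B H := by
      rw [← sum_weight_callProb (fun H => W H * irregular A B H) u]
      exact Finset.sum_congr rfl fun w _ => Finset.sum_congr rfl fun H _ => by ring
    have e2 : ∑ w, ∑ H, W H * callProb H u w * callAll (callProb H) (f H) L (insert w I)
        = ∑ H, W H * callAll (callProb H) (f H) (u :: L) I := by
      rw [Finset.sum_comm]
      refine Finset.sum_congr rfl fun H _ => ?_
      rw [callAll, Finset.mul_sum]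
      exact Finset.sum_congr rfl fun w _ => by ring
    rw [e1, e2] at hsum
    rw [List.length_cons, ← Nat.add_assoc, Nat.cast_succ]
    rw [callAll]
    linarith

open Classical in
/-- Averaged over the weights `W`, the push protocol is at least as fast as the lazy push protocol
on `G`, up to the weight of the irregular graphs. -/
theorem sum_weight_successProb_ge {G : SimpleGraph V} {p ρ A B δ : ℝ} {d m : ℕ}
    (hp0 : 0 ≤ p) (hp1 : p ≤ 1) (hρ0 : 0 ≤ ρ) (hA : 1 ≤ A) (hρ : ρ * (A + 1) ≤ A)
    (hB : 0 < B) (hδ0 : 0 ≤ δ) (hδ1 : δ ≤ 1) (hd : 0 < d)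
    (hG : ∀ u, (G.neighborSet u).ncard = d) (hβ : (1 - δ) / d ≤ p * ρ ^ m / B) (k : ℕ)
    (W : SimpleGraph V → ℝ) (I : Finset V) (j : V → ℕ) (hW : ∀ H, 0 ≤ W H)
    (h : EdgeWeightBound G p ρ A W I j) (hj : ∀ u, j u + k ≤ m) :
    (∑ H, W H) * successProb (lazy δ (callProb G)) k I
        - (k * Fintype.card V : ℕ) * ∑ H, W H * irregular A B H
      ≤ ∑ H, W H * successProb (callProb H) k I := by
  have hlz0 := lazy_nonneg hδ0 hδ1 (callProb_nonneg G)
  have hlz1 : ∀ u, ∑ w, lazy δ (callProb G) u w = 1 := sum_lazy (sum_callProb G)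
  induction k generalizing W I j with
  | zero => simp [successProb]
  | succ k ih =>
    have := sum_weight_callAll_ge hp0 hp1 hρ0 hA hρ hB hδ0 hδ1 hd hG hβ
      (successProb_mono hlz0 hlz1 k) (successProb_nonneg hlz0 k)
      (successProb_le_one hlz0 hlz1 k) ih I.toList W I j hW h (by
        intro u
        have h1 := hj u
        have h2 := List.nodup_iff_count_le_one.1 I.nodup_toList u
        omega) (fun u hu => Finset.mem_toList.1 hu)
    refine le_trans (sub_le_sub_left ?_ _) this
    refine mul_le_mul_of_nonneg_right ?_ (Finset.sum_nonneg fun H _ =>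
      mul_nonneg (hW H) (irregular_nonneg A B H))
    rw [Finset.length_toList, Nat.succ_mul]
    exact_mod_cast Nat.add_le_add_left (Finset.card_le_univ I) _

end Annealed

section Percolation

variable {V : Type*} [Fintype V]

theorem percolation_singleton_eq (G : SimpleGraph V) (p : unitInterval) (H : SimpleGraph V) :
    percolation G p {H}
      = ProbabilityTheory.setBernoulli G.edgeSet p {S | S = H.edgeSet ∧ S ⊆ G.edgeSet} := by
  rw [percolation, Measure.map_apply SimpleGraph.measurable_fromEdgeSet
    (MeasurableSet.singleton H), ProbabilityTheory.setBernoulli_apply_eq_apply_subsets]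
  congr 1
  ext S
  simp only [Set.mem_preimage, Set.mem_singleton_iff, Set.mem_ofPred_eq]
  refine and_congr_left fun hS => ?_
  constructor
  · rintro rfl
    rw [SimpleGraph.edgeSet_fromEdgeSet]
    ext e
    simp only [Set.mem_sdiff]
    exact ⟨fun h => ⟨h, G.not_isDiag_of_mem_edgeSet (hS h)⟩, fun h => h.1⟩
  · rintro rfl
    exact SimpleGraph.fromEdgeSet_edgeSet H

theorem percolation_real_of_le {G H : SimpleGraph V} (p : unitInterval) (h : H ≤ G) :
    (percolation G p).real {H}
      = (p : ℝ) ^ H.edgeSet.ncard * (1 - p : ℝ) ^ (G.edgeSet \ H.edgeSet).ncard := by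
  have hs : H.edgeSet ⊆ G.edgeSet := SimpleGraph.edgeSet_mono h
  have : {S | S = H.edgeSet ∧ S ⊆ G.edgeSet} = {H.edgeSet} := by
    ext S
    simp only [Set.mem_ofPred_eq, Set.mem_singleton_iff]
    exact ⟨fun h => h.1, fun h => ⟨h, h ▸ hs⟩⟩
  rw [measureReal_def, percolation_singleton_eq, this, ← measureReal_def,
    ProbabilityTheory.setBernoulli_real_singleton p hs (Set.toFinite _)]

theorem percolation_real_of_not_le {G H : SimpleGraph V} (p : unitInterval) (h : ¬ H ≤ G) :
    (percolation G p).real {H} = 0 := by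
  have : {S | S = H.edgeSet ∧ S ⊆ G.edgeSet} = ∅ := by
    ext S
    simp only [Set.mem_ofPred_eq, Set.mem_empty_iff_false, iff_false]
    rintro ⟨rfl, h'⟩
    exact h (SimpleGraph.edgeSet_subset_edgeSet.1 h')
  rw [measureReal_def, percolation_singleton_eq, this]
  simp

theorem percolation_real_sup_edge {G : SimpleGraph V} (p : unitInterval) {u w : V}
    (hG : G.Adj u w) {H : SimpleGraph V} (hH : ¬ H.Adj u w) :
    (p : ℝ) * (percolation G p).real {H}
      = (1 - p : ℝ) * (percolation G p).real {H ⊔ SimpleGraph.edge u w} := by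
  have hedge : SimpleGraph.edge u w ≤ G := (SimpleGraph.edge_le_iff ..).2 (Or.inr hG)
  by_cases h : H ≤ G
  · rw [percolation_real_of_le p h, percolation_real_of_le p (sup_le h hedge)]
    have hE : (H ⊔ SimpleGraph.edge u w).edgeSet = insert s(u, w) H.edgeSet := by
      rw [SimpleGraph.edgeSet_sup, SimpleGraph.edgeSet_edge_of_ne hG.ne, Set.union_comm]
      rfl
    have hnot : s(u, w) ∉ H.edgeSet := by simpa using hH
    have hmem : s(u, w) ∈ G.edgeSet \ H.edgeSet := ⟨by simpa using hG, hnot⟩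
    rw [hE, Set.ncard_insert_of_notMem hnot (Set.toFinite _),
      show G.edgeSet \ insert s(u, w) H.edgeSet = (G.edgeSet \ H.edgeSet) \ {s(u, w)} by
        ext e; simp; tauto,
      ← Set.ncard_sdiff_singleton_add_one hmem (Set.toFinite _), pow_succ, pow_succ]
    ring
  · rw [percolation_real_of_not_le p h,
      percolation_real_of_not_le p (fun h' => h (le_sup_left.trans h'))]
    simp

open Classical in
theorem sum_percolation_real (G : SimpleGraph V) (p : unitInterval) :
    ∑ H, (percolation G p).real {H} = 1 := by
  rw [sum_measureReal_singleton]
  simp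

theorem edgeWeightBound_percolation (G : SimpleGraph V) (p : unitInterval) (ρ A : ℝ)
    (I : Finset V) :
    EdgeWeightBound G p ρ A (fun H => (percolation G p).real {H}) I 0 := by
  intro u w hG _ H hH _
  simpa using (percolation_real_sup_edge p hG hH).le

open Classical in
theorem sum_percolation_pow (G : SimpleGraph V) (p : unitInterval) (u : V) (y : ℝ)
    (N : Finset V) (hN : ∀ w ∈ N, G.Adj u w) :
    ∑ H, (percolation G p).real {H} * y ^ (N.filter (H.Adj u)).card
      = (1 - p + p * y : ℝ) ^ N.card := by
  induction N using Finset.induction_on with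
  | empty => simp
  | insert w N hw ih =>
    have hG : G.Adj u w := hN w (Finset.mem_insert_self _ _)
    rw [Finset.card_insert_of_notMem hw, pow_succ,
      ← ih fun x hx => hN x (Finset.mem_insert_of_mem hx), sum_eq_sum_not_adj u w hG.ne,
      sum_eq_sum_not_adj u w hG.ne, Finset.sum_mul]
    refine Finset.sum_congr rfl fun H hH => ?_
    simp only [Finset.mem_filter, Finset.mem_univ, true_and] at hH
    have e := percolation_real_sup_edge p hG hH
    generalize hH' : H ⊔ SimpleGraph.edge u w = H' at e ⊢
    have hadj : H'.Adj u w := by simp [← hH', SimpleGraph.edge_adj, hG.ne]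
    have hiff : ∀ x ∈ N, (H'.Adj u x ↔ H.Adj u x) := by
      intro x hx
      have hxw : x ≠ w := fun h => hw (h ▸ hx)
      rw [← hH', SimpleGraph.sup_adj, SimpleGraph.edge_adj]
      grind
    rw [Finset.filter_insert, if_neg hH, Finset.filter_insert, if_pos hadj,
      Finset.filter_congr (p := H'.Adj u) (q := H.Adj u) hiff,
      Finset.card_insert_of_notMem (fun h => hw (Finset.mem_filter.1 h).1), pow_succ]
    linear_combination (y ^ (N.filter (H.Adj u)).card * (1 - y)) * e

open Classical in
theorem sum_percolation_exp_le {G : SimpleGraph V} (p : unitInterval) {u : V} {d : ℕ}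
    (hd : (G.neighborSet u).ncard = d) {l : ℝ} (hl : |l| ≤ 1) :
    ∑ H, (percolation G p).real {H} * Real.exp (l * (H.neighborSet u).ncard)
      ≤ Real.exp (p * d * (l + l ^ 2)) := by
  have hN := sum_percolation_pow G p u (Real.exp l) (Finset.univ.filter (G.Adj u))
    (fun w hw => (Finset.mem_filter.1 hw).2)
  have hcard (H : SimpleGraph V) : (Finset.univ.filter (H.Adj u)).card
      = (H.neighborSet u).ncard := by
    rw [← Set.ncard_coe_finset]
    congr 1
    ext x
    simp
  rw [hcard, hd] at hN
  have hlhs : ∑ H, (percolation G p).real {H} * Real.exp (l * (H.neighborSet u).ncard)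
      = (1 - p + p * Real.exp l : ℝ) ^ d := by
    rw [← hN]
    refine Finset.sum_congr rfl fun H _ => ?_
    by_cases h : H ≤ G
    · have : (Finset.univ.filter (G.Adj u)).filter (H.Adj u) = Finset.univ.filter (H.Adj u) := by
        ext x
        simp only [Finset.mem_filter, Finset.mem_univ, true_and, and_iff_right_iff_imp]
        exact fun hx => h hx
      rw [this, hcard, ← Real.exp_nat_mul, mul_comm l]
    · rw [percolation_real_of_not_le p h, zero_mul, zero_mul]
  rw [hlhs]
  have hexp : Real.exp l ≤ 1 + l + l ^ 2 := by
    have := (abs_le.1 (Real.abs_exp_sub_one_sub_id_le hl)).2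
    linarith
  have hp0 : (0 : ℝ) ≤ p := p.2.1
  have hp1 : (p : ℝ) ≤ 1 := p.2.2
  have hbase : (1 - p + p * Real.exp l : ℝ) ≤ Real.exp (p * (l + l ^ 2)) := by
    have h1 := Real.add_one_le_exp ((p : ℝ) * (l + l ^ 2))
    have h2 := mul_le_mul_of_nonneg_left hexp hp0
    linarith
  have hpos : (0 : ℝ) ≤ 1 - p + p * Real.exp l := by
    have := mul_nonneg hp0 (Real.exp_pos l).le
    linarith
  calc _ ≤ Real.exp (p * (l + l ^ 2)) ^ d := pow_le_pow_left₀ hpos hbase d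
    _ = _ := by rw [← Real.exp_nat_mul]; congr 1; ring

open Classical in
/-- In the percolated graph all degrees are close to their expected value `p d`. -/
theorem sum_percolation_irregular_le {G : SimpleGraph V} (p : unitInterval) {d : ℕ}
    (hG : ∀ u, (G.neighborSet u).ncard = d) {η : ℝ} (hη0 : 0 < η) (hη1 : η ≤ 1) :
    ∑ H, (percolation G p).real {H}
        * irregular ((1 - η) * (p * d) - 1) ((1 + η) * (p * d) + 1) H
      ≤ Fintype.card V * (2 * Real.exp (-(p * d * η ^ 2 / 4))) := by
  set μ : ℝ := p * d with hμ
  have hpt (H : SimpleGraph V) : irregular ((1 - η) * μ - 1) ((1 + η) * μ + 1) H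
      ≤ ∑ u, (Real.exp (η / 2 * (H.neighborSet u).ncard) * Real.exp (-(η / 2 * ((1 + η) * μ)))
        + Real.exp (-(η / 2) * (H.neighborSet u).ncard) * Real.exp (η / 2 * ((1 - η) * μ))) := by
    have hnn : ∀ u ∈ Finset.univ, 0 ≤ Real.exp (η / 2 * (H.neighborSet u).ncard)
          * Real.exp (-(η / 2 * ((1 + η) * μ)))
        + Real.exp (-(η / 2) * (H.neighborSet u).ncard) * Real.exp (η / 2 * ((1 - η) * μ)) :=
      fun u _ => by positivity
    unfold irregular
    split_ifs with h
    · exact Finset.sum_nonneg hnn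
    · push Not at h
      obtain ⟨u, hu⟩ := h
      refine le_trans ?_ (Finset.single_le_sum hnn (Finset.mem_univ u))
      rw [← Real.exp_add, ← Real.exp_add]
      by_cases hlow : (1 - η) * μ - 1 + 1 ≤ (H.neighborSet u).ncard
      · have hup := hu hlow
        have : 1 ≤ Real.exp (η / 2 * (H.neighborSet u).ncard + -(η / 2 * ((1 + η) * μ))) := by
          apply Real.one_le_exp
          have := mul_le_mul_of_nonneg_left (show (1 + η) * μ ≤ (H.neighborSet u).ncard by linarith)
            (show 0 ≤ η / 2 by linarith)
          linarith
        linarith [Real.exp_pos (-(η / 2) * (H.neighborSet u).ncard + η / 2 * ((1 - η) * μ))]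
      · have : 1 ≤ Real.exp (-(η / 2) * (H.neighborSet u).ncard + η / 2 * ((1 - η) * μ)) := by
          apply Real.one_le_exp
          have := mul_le_mul_of_nonneg_left (show (H.neighborSet u).ncard ≤ (1 - η) * μ by linarith)
            (show 0 ≤ η / 2 by linarith)
          linarith
        linarith [Real.exp_pos (η / 2 * (H.neighborSet u).ncard + -(η / 2 * ((1 + η) * μ)))]
  have habs : |η / 2| ≤ 1 := by rw [abs_of_pos (by linarith)]; linarith
  have habs' : |-(η / 2)| ≤ 1 := by rwa [abs_neg]
  have hvertex (u : V) : ∑ H, (percolation G p).real {H}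
      * (Real.exp (η / 2 * (H.neighborSet u).ncard) * Real.exp (-(η / 2 * ((1 + η) * μ)))
        + Real.exp (-(η / 2) * (H.neighborSet u).ncard) * Real.exp (η / 2 * ((1 - η) * μ)))
      ≤ 2 * Real.exp (-(μ * η ^ 2 / 4)) := by
    have e1 := mul_le_mul_of_nonneg_right (sum_percolation_exp_le p (hG u) habs)
      (Real.exp_pos (-(η / 2 * ((1 + η) * μ)))).le
    have e2 := mul_le_mul_of_nonneg_right (sum_percolation_exp_le p (hG u) habs')
      (Real.exp_pos (η / 2 * ((1 - η) * μ))).le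
    rw [← Real.exp_add, ← hμ, show μ * (η / 2 + (η / 2) ^ 2) + -(η / 2 * ((1 + η) * μ))
      = -(μ * η ^ 2 / 4) by ring] at e1
    rw [← Real.exp_add, ← hμ, show μ * (-(η / 2) + (-(η / 2)) ^ 2) + η / 2 * ((1 - η) * μ)
      = -(μ * η ^ 2 / 4) by ring] at e2
    have hsplit (a b c b' c' : ℝ) : a * (b * c + b' * c') = a * b * c + a * b' * c' := by ring
    simp only [hsplit, Finset.sum_add_distrib, ← Finset.sum_mul]
    linarith
  calc _ ≤ ∑ H, (percolation G p).real {H} * ∑ u,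
        (Real.exp (η / 2 * (H.neighborSet u).ncard) * Real.exp (-(η / 2 * ((1 + η) * μ)))
        + Real.exp (-(η / 2) * (H.neighborSet u).ncard) * Real.exp (η / 2 * ((1 - η) * μ))) :=
        Finset.sum_le_sum fun H _ => mul_le_mul_of_nonneg_left (hpt H) measureReal_nonneg
    _ = ∑ u, ∑ H, (percolation G p).real {H}
      * (Real.exp (η / 2 * (H.neighborSet u).ncard) * Real.exp (-(η / 2 * ((1 + η) * μ)))
        + Real.exp (-(η / 2) * (H.neighborSet u).ncard) * Real.exp (η / 2 * ((1 - η) * μ))) := by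
        simp only [Finset.mul_sum]
        rw [Finset.sum_comm]
    _ ≤ ∑ _u : V, 2 * Real.exp (-(μ * η ^ 2 / 4)) := Finset.sum_le_sum fun u _ => hvertex u
    _ = _ := by rw [Finset.sum_const, nsmul_eq_mul, Finset.card_univ]

variable [MeasurableSpace V] [DiscreteMeasurableSpace V]

open Classical in
theorem percolatedPushLaw_real_runtimeLE (G : SimpleGraph V) (p : unitInterval) (v : V) {x : ℝ}
    (hx : 0 ≤ x) :
    (percolatedPushLaw G p).real {ω | RuntimeLE v ω.2 x}
      = ∑ H, (percolation G p).real {H} * successProb (callProb H) ⌊x⌋₊ {v} := by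
  have hm : MeasurableSet {ω : SimpleGraph V × (ℕ × V → V) | RuntimeLE v ω.2 x} :=
    measurable_snd (measurableSet_runtimeLE v x)
  rw [measureReal_def, percolatedPushLaw, Measure.compProd_apply hm, lintegral_fintype,
    ENNReal.toReal_sum (fun H _ => ENNReal.mul_ne_top (measure_ne_top _ _) (measure_ne_top _ _))]
  refine Finset.sum_congr rfl fun H _ => ?_
  rw [ENNReal.toReal_mul, mul_comm, ← pushLaw_real_runtimeLE H v hx]
  rfl

/-- A quantitative version of the comparison of the runtimes on a regular graph and on its
percolation. -/
theorem percolatedPushLaw_real_ge {G : SimpleGraph V} (p : unitInterval) {d : ℕ}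
    (hG : ∀ u, (G.neighborSet u).ncard = d) (v : V) {x x' : ℝ} (hx : 0 ≤ x) (hx' : 0 ≤ x')
    {δ η M : ℝ} (hδ0 : 0 ≤ δ) (hδ1 : δ ≤ 1) (hM : 1 ≤ M) (hη0 : 0 < η) (hη1 : η ≤ 1)
    (hμ : 2 ≤ (1 - η) * (p * d))
    (hβ : (1 - δ) / d ≤ p * (((1 - η) * (p * d) - 1) / ((1 - η) * (p * d))) ^ ⌊x'⌋₊
      / ((1 + η) * (p * d) + 1)) :
    (pushLaw G).real {c | RuntimeLE v c x}
        - Fintype.card V * ((δ + (1 - δ) / M) ^ ⌊x'⌋₊ * M ^ ⌊x⌋₊)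
        - (⌊x'⌋₊ * Fintype.card V) * (Fintype.card V * (2 * Real.exp (-(p * d * η ^ 2 / 4))))
      ≤ (percolatedPushLaw G p).real {ω | RuntimeLE v ω.2 x'} := by
  classical
  have hp0 : (0 : ℝ) ≤ p := p.2.1
  have hp1 : (p : ℝ) ≤ 1 := p.2.2
  have hd : 0 < d := by
    rcases Nat.eq_zero_or_pos d with rfl | h
    · norm_num at hμ
    · exact h
  rw [percolatedPushLaw_real_runtimeLE G p v hx', pushLaw_real_runtimeLE G v hx]
  have h1 := successProb_lazy_ge G hδ0 hδ1 hM v ⌊x⌋₊ ⌊x'⌋₊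
  have h2 := sum_weight_successProb_ge (G := G) (p := p) (A := (1 - η) * (p * d) - 1)
    (B := (1 + η) * (p * d) + 1) (m := ⌊x'⌋₊) hp0 hp1
    (ρ := ((1 - η) * (p * d) - 1) / ((1 - η) * (p * d)))
    (div_nonneg (by linarith) (by linarith)) (by linarith)
    (by rw [sub_add_cancel, div_mul_cancel₀ _ (by linarith)]) (by positivity)
    hδ0 hδ1 hd hG hβ ⌊x'⌋₊ (fun H => (percolation G p).real {H}) {v} 0
    (fun H => measureReal_nonneg) (edgeWeightBound_percolation G p _ _ _) (by simp)
  rw [sum_percolation_real, one_mul] at h2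
  have h3 := mul_le_mul_of_nonneg_left (sum_percolation_irregular_le p hG hη0 hη1)
    (show (0 : ℝ) ≤ (⌊x'⌋₊ * Fintype.card V : ℕ) by positivity)
  push_cast at h2 h3
  linarith

end Percolation

section Asymptotics

open Filter Topology

theorem ncard_informed_le {V : Type*} (v : V) (c : ℕ × V → V) (t : ℕ) :
    (informed v c t).Finite ∧ (informed v c t).ncard ≤ 2 ^ t := by
  induction t with
  | zero => simp [informed]
  | succ t ih =>
    refine ⟨ih.1.union (ih.1.image _), ?_⟩
    calc _ ≤ (informed v c t).ncard + ((fun u => c (t, u)) '' informed v c t).ncard :=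
          Set.ncard_union_le _ _
      _ ≤ 2 ^ t + 2 ^ t := add_le_add ih.2 ((Set.ncard_image_le ih.1).trans ih.2)
      _ = _ := by ring

theorem card_le_two_rpow {V : Type*} [Fintype V] {v : V} {c : ℕ × V → V} {x : ℝ}
    (h : RuntimeLE v c x) : 0 ≤ x ∧ (Fintype.card V : ℝ) ≤ 2 ^ x := by
  rw [runtimeLE_iff] at h
  refine ⟨h.1, ?_⟩
  have := (ncard_informed_le v c ⌊x⌋₊).2
  rw [h.2, Set.ncard_univ, Nat.card_eq_fintype_card] at this
  calc (Fintype.card V : ℝ) ≤ (2 : ℝ) ^ ⌊x⌋₊ := by exact_mod_cast this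
    _ = (2 : ℝ) ^ (⌊x⌋₊ : ℝ) := (Real.rpow_natCast _ _).symm
    _ ≤ 2 ^ x := Real.rpow_le_rpow_of_exponent_le one_le_two (Nat.floor_le h.1)

theorem lazy_rate_le {δ η μ : ℝ} {d m : ℕ} {p : ℝ} (hμ : μ = p * d) (hδ0 : 0 < δ) (hδ1 : δ ≤ 1)
    (hη : η = δ / 2) (hm : 4 * m + 2 ≤ μ * δ) (hd : 0 < d) :
    (1 - δ) / d ≤ p * (((1 - η) * μ - 1) / ((1 - η) * μ)) ^ m / ((1 + η) * μ + 1) := by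
  have hm0 : (0 : ℝ) ≤ m := m.cast_nonneg
  have hμ2 : 2 ≤ μ := by
    by_contra hc
    nlinarith
  have hμ0 : 0 < μ := by linarith
  have hη2 : (1 : ℝ) / 2 ≤ 1 - η := by linarith
  have hA : 1 ≤ (1 - η) * μ := by nlinarith
  have hA0 : 0 < (1 - η) * μ := by linarith
  have hB0 : 0 < (1 + η) * μ + 1 := by nlinarith
  have hd0 : (0 : ℝ) < d := by exact_mod_cast hd
  have hb := one_add_mul_le_pow (a := -(1 / ((1 - η) * μ))) (by
    have : 1 / ((1 - η) * μ) ≤ 1 := by rw [div_le_one hA0]; exact hA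
    linarith) m
  rw [show 1 + -(1 / ((1 - η) * μ)) = ((1 - η) * μ - 1) / ((1 - η) * μ) by
    field_simp; ring] at hb
  have hdiv : (m : ℝ) * (1 / ((1 - η) * μ)) * μ ≤ 2 * m := by
    rw [mul_one_div, div_mul_eq_mul_div, div_le_iff₀ hA0]
    have := mul_le_mul_of_nonneg_left hη2 (mul_nonneg hm0 hμ0.le)
    linarith
  have hpow := mul_le_mul_of_nonneg_right hb hμ0.le
  rw [div_le_div_iff₀ hd0 hB0]
  have hkey : (1 - δ) * ((1 + η) * μ + 1) ≤ μ - 2 * m := by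
    subst hη
    nlinarith
  calc (1 - δ) * ((1 + η) * μ + 1) ≤ μ - 2 * m := hkey
    _ ≤ (((1 - η) * μ - 1) / ((1 - η) * μ)) ^ m * μ := by linarith
    _ = _ := by nth_rewrite 3 [hμ]; ring

theorem delay_error_le {n T ε M : ℝ} {m m' : ℕ} (hε : 0 < ε)
    (hn : n ≤ 2 ^ T) (hM : M = 2 ^ ((3 + ε) / ε)) (hm : m ≤ T) (hm' : (1 + ε) * T ≤ m' + 1) :
    n * ((1 / M + (1 - 1 / M) / M) ^ m' * M ^ m) ≤ M / 2 * 2 ^ (-T) := by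
  have hexp : 1 ≤ (3 + ε) / ε := by rw [le_div_iff₀ hε]; linarith
  have hM2 : 2 ≤ M := by
    rw [hM]
    calc (2 : ℝ) = 2 ^ (1 : ℝ) := by simp
      _ ≤ _ := Real.rpow_le_rpow_of_exponent_le one_le_two hexp
  have hM0 : 0 < M := by linarith
  have hq : 1 / M + (1 - 1 / M) / M ≤ 2 / M := by
    have : (1 - 1 / M) / M ≤ 1 / M := by
      gcongr
      have : 0 < 1 / M := by positivity
      linarith
    calc _ ≤ 1 / M + 1 / M := by linarith
      _ = _ := by ring
  have hq0 : 0 ≤ 1 / M + (1 - 1 / M) / M := by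
    have : 1 / M ≤ 1 := by rw [div_le_one hM0]; linarith
    have h2 : 0 ≤ 1 - 1 / M := by linarith
    positivity
  have h2M : 2 / M ≤ 1 := by rw [div_le_one hM0]; exact hM2
  have h2M0 : 0 < 2 / M := by positivity
  have e1 : (1 / M + (1 - 1 / M) / M) ^ m' ≤ (2 / M) ^ ((1 + ε) * T - 1) := by
    calc _ ≤ (2 / M) ^ m' := pow_le_pow_left₀ hq0 hq m'
      _ = (2 / M) ^ (m' : ℝ) := (Real.rpow_natCast _ _).symm
      _ ≤ _ := Real.rpow_le_rpow_of_exponent_ge h2M0 h2M (by linarith)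
  have e2 : M ^ m ≤ M ^ T := by
    rw [← Real.rpow_natCast]
    exact Real.rpow_le_rpow_of_exponent_le (by linarith) hm
  calc n * ((1 / M + (1 - 1 / M) / M) ^ m' * M ^ m)
      ≤ 2 ^ T * ((2 / M) ^ ((1 + ε) * T - 1) * M ^ T) := by gcongr
    _ = M / 2 * (2 ^ T * ((2 / M) ^ ((1 + ε) * T) * M ^ T)) := by
        rw [Real.rpow_sub h2M0, Real.rpow_one]
        field_simp
    _ = M / 2 * 2 ^ (-T) := by
        congr 1
        rw [Real.div_rpow zero_le_two hM0.le, hM]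
        rw [← Real.rpow_mul zero_le_two, ← Real.rpow_mul zero_le_two,
          ← Real.rpow_sub zero_lt_two, ← Real.rpow_add zero_lt_two, ← Real.rpow_add zero_lt_two]
        congr 1
        field_simp
        ring

theorem degree_error_le {n T ε μ η : ℝ} {m' : ℕ} (hT : 0 ≤ T) (hn0 : 0 ≤ n)
    (hn : n ≤ 2 ^ T) (hm' : m' ≤ (1 + ε) * T) (hμ : 3 * T ≤ μ * η ^ 2 / 4) :
    m' * n * (n * (2 * Real.exp (-(μ * η ^ 2 / 4)))) ≤ 2 * (1 + ε) * (T * Real.exp (-T)) := by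
  have h2 : (2 : ℝ) ^ T ≤ Real.exp T := by
    rw [Real.rpow_def_of_pos zero_lt_two]
    apply Real.exp_le_exp.2
    have := mul_le_mul_of_nonneg_right (Real.log_two_lt_d9.le.trans (by norm_num :
      (0.6931471808 : ℝ) ≤ 1)) hT
    linarith
  have hn' := hn.trans h2
  calc m' * n * (n * (2 * Real.exp (-(μ * η ^ 2 / 4))))
      ≤ ((1 + ε) * T) * Real.exp T * (Real.exp T * (2 * Real.exp (-(3 * T)))) := by
        have : Real.exp (-(μ * η ^ 2 / 4)) ≤ Real.exp (-(3 * T)) :=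
          Real.exp_le_exp.2 (by linarith)
        have h0 : (0 : ℝ) ≤ m' := m'.cast_nonneg
        have h1 : 0 ≤ (1 + ε) * T := h0.trans hm'
        gcongr
    _ = 2 * (1 + ε) * (T * (Real.exp T * Real.exp T * Real.exp (-(3 * T)))) := by ring
    _ = _ := by
        rw [← Real.exp_add, ← Real.exp_add]
        congr 3
        ring

theorem withHighProbability_iff {Ω : ℕ → Type*} [∀ k, MeasurableSpace (Ω k)]
    {P : ∀ k, Measure (Ω k)} [∀ k, IsProbabilityMeasure (P k)] {E : ∀ k, Set (Ω k)} :
    WithHighProbability P E ↔ Tendsto (fun k => (P k).real (E k)) atTop (𝓝 1) := by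
  rw [WithHighProbability, ← ENNReal.tendsto_toReal_iff (fun k => measure_ne_top _ _)
    ENNReal.one_ne_top]
  rfl

/-- For regular graphs and large `T`, the loss in the success probability that is caused by the
percolation is small. -/
theorem percolatedPushLaw_real_ge_sub {ε : ℝ} (hε : 0 < ε) : ∃ C D : ℝ, 0 < C ∧
    ∀ {V : Type*} [Fintype V] [MeasurableSpace V] [DiscreteMeasurableSpace V] (G : SimpleGraph V)
      (p : unitInterval) (d : ℕ) (v : V) (T : ℝ), (∀ u, (G.neighborSet u).ncard = d) →
      1 ≤ T → (Fintype.card V : ℝ) ≤ 2 ^ T → C * T ≤ p * d →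
      (pushLaw G).real {c | RuntimeLE v c T} - D * 2 ^ (-T) - 2 * (1 + ε) * (T * Real.exp (-T))
        ≤ (percolatedPushLaw G p).real {ω | RuntimeLE v ω.2 ((1 + ε) * T)} := by
  obtain ⟨M, hM⟩ : ∃ M : ℝ, M = 2 ^ ((3 + ε) / ε) := ⟨_, rfl⟩
  have hM1 : 1 ≤ M := by
    rw [hM]
    exact Real.one_le_rpow one_le_two (by positivity)
  have hM0 : 0 < M := by linarith
  obtain ⟨δ, hδ⟩ : ∃ δ : ℝ, δ = 1 / M := ⟨_, rfl⟩
  have hδ0 : 0 < δ := by rw [hδ]; positivity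
  have hδ1 : δ ≤ 1 := by rw [hδ, div_le_one hM0]; exact hM1
  obtain ⟨η, hη⟩ : ∃ η : ℝ, η = δ / 2 := ⟨_, rfl⟩
  have hη0 : 0 < η := by linarith
  refine ⟨4 + (6 + 4 * ε) / δ + 12 / η ^ 2, M / 2, by positivity, ?_⟩
  intro V _ _ _ G p d v T hG hT hn hC
  have hT0 : 0 ≤ T := by linarith
  set μ : ℝ := p * d with hμ
  have hC0 : 0 ≤ (6 + 4 * ε) / δ * T := by positivity
  have hC1 : 0 ≤ 12 / η ^ 2 * T := by positivity
  have hμ4 : 4 ≤ μ := by linarith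
  have hd : 0 < d := by
    rcases Nat.eq_zero_or_pos d with rfl | h
    · norm_num [hμ] at hμ4
    · exact h
  have hm : (⌊T⌋₊ : ℝ) ≤ T := Nat.floor_le hT0
  have hT'0 : 0 ≤ (1 + ε) * T := by positivity
  have hm' : (⌊(1 + ε) * T⌋₊ : ℝ) ≤ (1 + ε) * T := Nat.floor_le hT'0
  have hm'' : (1 + ε) * T ≤ ⌊(1 + ε) * T⌋₊ + 1 := (Nat.lt_floor_add_one _).le
  have hμδ : 4 * (⌊(1 + ε) * T⌋₊ : ℝ) + 2 ≤ μ * δ := by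
    have h1 : (6 + 4 * ε) / δ * T ≤ μ := by linarith
    have h2 := mul_le_mul_of_nonneg_right h1 hδ0.le
    rw [div_mul_eq_mul_div, div_mul_cancel₀ _ hδ0.ne'] at h2
    linarith
  have hμη : 3 * T ≤ μ * η ^ 2 / 4 := by
    have h1 : 12 / η ^ 2 * T ≤ μ := by linarith
    have h2 := mul_le_mul_of_nonneg_right h1 (sq_nonneg η)
    rw [div_mul_eq_mul_div, div_mul_cancel₀ _ (by positivity)] at h2
    linarith
  have hmain := percolatedPushLaw_real_ge p hG v hT0 hT'0 hδ0.le hδ1 hM1 hη0 (by linarith)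
    (by rw [← hμ]; nlinarith) (lazy_rate_le hμ hδ0 hδ1 hη hμδ hd)
  have e1 := delay_error_le (n := Fintype.card V) hε hn hM hm hm''
  have e2 := degree_error_le (n := Fintype.card V) hT0 (by positivity) hn hm' hμη
  rw [← hδ] at e1
  linarith

theorem tendsto_two_rpow_neg {T : ℕ → ℝ} (hT : Tendsto T atTop atTop) :
    Tendsto (fun n => (2 : ℝ) ^ (-T n)) atTop (𝓝 0) := by
  have h : Tendsto (fun x : ℝ => Real.exp (-(Real.log 2 * x))) atTop (𝓝 0) :=
    Real.tendsto_exp_neg_atTop_nhds_zero.comp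
      (tendsto_id.const_mul_atTop (Real.log_pos one_lt_two))
  refine (h.comp hT).congr fun n => ?_
  rw [Function.comp_apply, Real.rpow_def_of_pos zero_lt_two]
  congr 1
  ring

end Asymptotics
end RumorSpreading

theorem theorem1 (V : ℕ → Type*) [∀ n, Fintype (V n)]
    [∀ n, MeasurableSpace (V n)] [∀ n, DiscreteMeasurableSpace (V n)]
    (hV : Filter.Tendsto (fun n => Fintype.card (V n)) Filter.atTop Filter.atTop)
    (G : ∀ n, SimpleGraph (V n)) [∀ n, (G n).LocallyFinite] (d : ℕ → ℕ)
    (hG : ∀ n, (G n).IsRegularOfDegree (d n)) (v : ∀ n, V n) (T : ℕ → ℝ)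
    (hT : RumorSpreading.WithHighProbability (fun n => RumorSpreading.pushLaw (G n))
      (fun n => {c | RumorSpreading.RuntimeLE (v n) c (T n)}))
    (ε : ℝ) (hε : 0 < ε) (p : ℕ → unitInterval) (hp : ∀ n, 0 < p n ∧ p n < 1)
    (hTp : T =o[Filter.atTop] fun n => (p n : ℝ) * (d n : ℝ)) :
    RumorSpreading.WithHighProbability
      (fun n => RumorSpreading.percolatedPushLaw (G n) (p n))
      (fun n => {ω | RumorSpreading.RuntimeLE (v n) ω.2 ((1 + ε) * T n)}) := by
  have hP : ∀ n, MeasureTheory.IsProbabilityMeasure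
      (RumorSpreading.percolatedPushLaw (G n) (p n)) := by
    intro n
    unfold RumorSpreading.percolatedPushLaw
    infer_instance
  rw [RumorSpreading.withHighProbability_iff] at hT ⊢
  have hcard : ∀ᶠ n in Filter.atTop, 0 ≤ T n ∧ (Fintype.card (V n) : ℝ) ≤ 2 ^ T n := by
    filter_upwards [hT.eventually (lt_mem_nhds zero_lt_one)] with n hn
    obtain ⟨c, hc⟩ : {c | RumorSpreading.RuntimeLE (v n) c (T n)}.Nonempty := by
      by_contra h
      rw [Set.not_nonempty_iff_eq_empty] at h
      rw [h, MeasureTheory.measureReal_empty] at hn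
      exact lt_irrefl _ hn
    exact RumorSpreading.card_le_two_rpow hc
  have hTtop : Filter.Tendsto T Filter.atTop Filter.atTop := by
    have hlog : Filter.Tendsto (fun n => Real.logb 2 (Fintype.card (V n)))
        Filter.atTop Filter.atTop :=
      (Real.tendsto_logb_atTop one_lt_two).comp (tendsto_natCast_atTop_atTop.comp hV)
    refine Filter.tendsto_atTop_mono' _ ?_ hlog
    filter_upwards [hcard] with n hn
    have hpos : (0 : ℝ) < Fintype.card (V n) := by
      exact_mod_cast Fintype.card_pos_iff.2 ⟨v n⟩
    exact (Real.logb_le_iff_le_rpow one_lt_two hpos).2 hn.2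
  obtain ⟨C, D, hC, hmain⟩ := RumorSpreading.percolatedPushLaw_real_ge_sub hε
  have hlow : Filter.Tendsto (fun n =>
      (RumorSpreading.pushLaw (G n)).real {c | RumorSpreading.RuntimeLE (v n) c (T n)}
      - D * 2 ^ (-T n) - 2 * (1 + ε) * (T n * Real.exp (-T n))) Filter.atTop (nhds 1) := by
    have hexp : Filter.Tendsto (fun n => T n * Real.exp (-T n)) Filter.atTop (nhds 0) := by
      have := (Real.tendsto_pow_mul_exp_neg_atTop_nhds_zero 1).comp hTtop
      simpa [Function.comp_def] using this
    have := (hT.sub ((RumorSpreading.tendsto_two_rpow_neg hTtop).const_mul D)).sub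
      (hexp.const_mul (2 * (1 + ε)))
    simpa using this
  refine tendsto_of_tendsto_of_tendsto_of_le_of_le' hlow tendsto_const_nhds ?_
    (Filter.Eventually.of_forall fun n => MeasureTheory.measureReal_le_one)
  filter_upwards [hcard, hTtop.eventually_ge_atTop 1, hTp.def (inv_pos.2 hC)] with n hn hT1 hTn
  refine hmain (G n) (p n) (d n) (v n) (T n) (fun u => ?_) hT1 hn.2 ?_
  · rw [Set.ncard_eq_toFinset_card', ← hG n u]
    rfl
  · have hpd : (0 : ℝ) ≤ p n * d n := mul_nonneg (p n).2.1 (Nat.cast_nonneg _)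
    rw [Real.norm_of_nonneg (by linarith), Real.norm_of_nonneg hpd, inv_mul_eq_div,
      le_div_iff₀ hC] at hTn
    linarith
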